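/- **Error of the ideal enriched correction.** Let $d\ge 1$, $k\ge 1$, $p=k-1$ and $\alpha>0$. There is a constant $C>0$ that depends only on $d$, $k$ and $\alpha$ such that the following holds. *Setting.* Let $\Omega\subset\mathbb R^d$ be open and bounded, $T>0$, and let $A$ be a measurable coefficient with $\alpha\le A\le\beta$ a.e. in $\Omega$ for some $\beta<\infty$. Write $(\cdot,\cdot)$ and $\|\cdot\|$ for the inner product and norm of $L^2(\Omega)$ and $a(v,w)=(A\nabla v,\nabla w)$. Let $\mathcal T_H$ be a decomposition of $\Omega$ into finitely many $d$-rectangles $\prod_i[a_i,b_i]$ with disjoint interiors contained in $\Omega$, with largest diameter $H$. Let $H^k(\mathcal T_H)$ be the space of all $v\in L^2(\Omega)$ with $v|_K\in H^k(K)$ for every $K\in\mathcal T_H$, with $\|v\|_{H^k(\mathcal T_H)}^2=\sum_K\|v\|_{H^k(K)}^2$. *Spaces and operators.* Let $V_H$ be the space of functions that are on each element a polynomial of partial degree at most $p$, let $\Pi$ be the $L^2$-projection onto $V_H$, and $W=\{w\in H^1_0(\Omega):\Pi w=0\}$. Let $\mathcal B\colon V_H\to H^1_0(\Omega)$ be a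 bubble operator: a linear map which sends each $v\in V_H$ supported in one element $K$ to a function in $H^1_0(K)$ with the same $L^2$-projection onto $V_H$. Let $\mathcal I=\mathcal E\circ\pi_H$, where $\pi_H$ is the $L^2$-projection onto piecewise constants and $\mathcal E$ is a linear (averaging) operator from piecewise constants to the functions in $H^1_0(\Omega)$ that are continuous on $\overline\Omega$ and on each element polynomials of partial degree at most one. Put $\mathcal X v=\mathcal I v+\mathcal B\,\Pi(v-\mathcal I v)$ and $U_H=\mathcal X V_H$. The correction operator is $\mathcal C=\sum_{K\in\mathcal T_H}\mathcal C_K$, where $\mathcal C_Kv\in W$ satisfies $a(\mathcal C_Kv,w)=(A\nabla v,\nabla w)_{L^2(K)}$ for all $w\in W$. The multiscale space is $\widetilde V_H=(1-\mathcal C)U_H$; the projection $\widetilde P v\in\widetilde V_H$ of $v\in H^1_0(\Omega)$ satisfies $a(\widetilde P v,z)=a(v,z)$ for all $z\in\widetilde V_H$. For $F\in H^{-1}(\Omega)$ (in particular for $F\in L^2(\Omega)$, identified with $w\mapsto(F,w)$) the enriched correction $\mathcal DF\in W$ satisfies $a(\mathcal DF,w)=-\langle F,w\rangle$ for all $w\in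 W$. *Solution.* Let $u_0\in H^1_0(\Omega)$, $f\in C([0,T];H^k(\mathcal T_H))$, and let $u\colon[0,T]\to H^1_0(\Omega)$ be a solution of $$\langle\partial_tu(t),v\rangle+a(u(t),v)=(f(t),v)\quad\text{for all }v\in H^1_0(\Omega),\ t\in[0,T],\qquad u(0)=u_0,$$ where $u$ is differentiable on $[0,T]$ as a function with values in $H^{-1}(\Omega)$. *Claim.* For all $t\in[0,T]$, the functions $\widetilde P u(t)$ and $\mathcal D(\partial_tu(t))$ exist and are unique, and $$\sup_{t\in[0,T]}\big\|\nabla\big(u(t)-(\widetilde P u(t)+\mathcal D(\partial_tu(t)))\big)\big\|\le C\,H^{p+2}\sup_{t\in[0,T]}\|f(t)\|_{H^k(\mathcal T_H)}.$$ -/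

import Mathlib

open MeasureTheory Set
open scoped ContDiff

noncomputable section

namespace MultiscaleHeat

variable {d : ℕ}

/-! ### Lebesgue and Sobolev spaces

Points of `ℝ^d` are functions `Fin d → ℝ`; the measure is Lebesgue measure. -/

/-- The Lebesgue space `L²(Ω)`. -/
abbrev L2 (Ω : Set (Fin d → ℝ)) : Type :=
  Lp ℝ 2 ((volume : Measure (Fin d → ℝ)).restrict Ω)

/-- The partial derivative `∂φ/∂x_i`. -/
def pderiv (i : Fin d) (φ : (Fin d → ℝ) → ℝ) (x : Fin d → ℝ) : ℝ :=
  fderiv ℝ φ x (Pi.single i 1)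

/-- `φ ∈ C_c^∞(U)`. -/
structure IsTestFun (U : Set (Fin d → ℝ)) (φ : (Fin d → ℝ) → ℝ) : Prop where
  smooth : ContDiff ℝ ∞ φ
  compact : HasCompactSupport φ
  supp : tsupport φ ⊆ U

theorem IsTestFun.zero (U : Set (Fin d → ℝ)) : IsTestFun U (fun _ => 0) where
  smooth := contDiff_const
  compact := HasCompactSupport.zero
  supp := by
    have h : tsupport (fun _ : Fin d → ℝ => (0 : ℝ)) = ∅ := tsupport_eq_empty_iff.2 rfl
    simp [h]

theorem IsTestFun.add {U : Set (Fin d → ℝ)} {φ ψ : (Fin d → ℝ) → ℝ}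
    (hφ : IsTestFun U φ) (hψ : IsTestFun U ψ) : IsTestFun U (fun x => φ x + ψ x) where
  smooth := hφ.smooth.add hψ.smooth
  compact := hφ.compact.add hψ.compact
  supp := (tsupport_add φ ψ).trans (union_subset hφ.supp hψ.supp)

theorem IsTestFun.const_mul {U : Set (Fin d → ℝ)} {φ : (Fin d → ℝ) → ℝ}
    (hφ : IsTestFun U φ) (c : ℝ) : IsTestFun U (fun x => c * φ x) where
  smooth := contDiff_const.mul hφ.smooth
  compact := hφ.compact.mul_left
  supp := (tsupport_mul_subset_right (f := fun _ => c) (g := φ)).trans hφ.supp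

/-- Tuples `(v, g_1, …, g_d)` of functions in `L²(Ω)`: a Sobolev function together with its
gradient. The norm is the norm `(‖v‖² + ‖∇v‖²)^{1/2}` of `H¹(Ω)`. -/
abbrev GradPair (Ω : Set (Fin d → ℝ)) : Type :=
  PiLp 2 (fun _ : Option (Fin d) => L2 Ω)

/-- The tuples `(φ, ∇φ)` with `φ ∈ C_c^∞(U)`. -/
def testPairs (Ω U : Set (Fin d → ℝ)) : Submodule ℝ (GradPair Ω) where
  carrier := {w | ∃ φ : (Fin d → ℝ) → ℝ, IsTestFun U φ ∧
    (w none =ᵐ[volume.restrict Ω] φ) ∧ ∀ i, (w (some i) =ᵐ[volume.restrict Ω] pderiv i φ)}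
  zero_mem' := by
    refine ⟨fun _ => 0, IsTestFun.zero U, ?_, fun i => ?_⟩
    · exact Lp.coeFn_zero ℝ 2 _
    · have h : pderiv i (fun _ : Fin d → ℝ => (0 : ℝ)) = fun _ => 0 := by
        funext x; simp [pderiv]
      rw [h]; exact Lp.coeFn_zero ℝ 2 _
  add_mem' := by
    rintro w z ⟨φ, hφ, h0, h1⟩ ⟨ψ, hψ, k0, k1⟩
    refine ⟨fun x => φ x + ψ x, hφ.add hψ, ?_, fun i => ?_⟩
    · filter_upwards [Lp.coeFn_add (w none) (z none), h0, k0] with x hx h k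
      rw [PiLp.add_apply, hx, Pi.add_apply, h, k]
    · filter_upwards [Lp.coeFn_add (w (some i)) (z (some i)), h1 i, k1 i] with x hx h k
      rw [PiLp.add_apply, hx, Pi.add_apply, h, k]
      have hd1 := (hφ.smooth.differentiable (by simp)) x
      have hd2 := (hψ.smooth.differentiable (by simp)) x
      simp only [pderiv]
      rw [fderiv_fun_add hd1 hd2]; rfl
  smul_mem' := by
    rintro c w ⟨φ, hφ, h0, h1⟩
    refine ⟨fun x => c * φ x, hφ.const_mul c, ?_, fun i => ?_⟩
    · filter_upwards [Lp.coeFn_smul c (w none), h0] with x hx h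
      rw [PiLp.smul_apply, hx, Pi.smul_apply, h, smul_eq_mul]
    · filter_upwards [Lp.coeFn_smul c (w (some i)), h1 i] with x hx h
      rw [PiLp.smul_apply, hx, Pi.smul_apply, h, smul_eq_mul]
      have hd1 := (hφ.smooth.differentiable (by simp)) x
      simp only [pderiv]
      rw [fderiv_const_mul hd1]; rfl

/-- For `U ⊆ Ω`, the space `H¹₀(U)`, extended by zero to `Ω`: the closure of `C_c^∞(U)` in the
norm of `H¹`. -/
def sobolevZero (Ω U : Set (Fin d → ℝ)) : Submodule ℝ (GradPair Ω) :=
  (testPairs Ω U).topologicalClosure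

/-- The Hilbert space `H¹₀(Ω)`. -/
abbrev H10 (Ω : Set (Fin d → ℝ)) : Type := ↥(sobolevZero Ω Ω)

variable {Ω : Set (Fin d → ℝ)}

/-- The embedding `H¹₀(Ω) → L²(Ω)`. -/
def toL2 : H10 Ω →L[ℝ] L2 Ω :=
  (PiLp.proj 2 (fun _ : Option (Fin d) => L2 Ω) none).comp (sobolevZero Ω Ω).subtypeL

/-- The weak partial derivative `∂_i u ∈ L²(Ω)` of `u ∈ H¹₀(Ω)`. -/
def grad (i : Fin d) (u : H10 Ω) : L2 Ω := (u : GradPair Ω) (some i)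

/-- The norm `‖∇u‖` in `L²(Ω)`. -/
def gradNorm (u : H10 Ω) : ℝ := Real.sqrt (∑ i, ‖grad i u‖ ^ 2)

/-- The dual space `H⁻¹(Ω)` of `H¹₀(Ω)`. -/
abbrev HMinusOne (Ω : Set (Fin d → ℝ)) : Type := StrongDual ℝ (H10 Ω)

/-- The embedding `L²(Ω) → H⁻¹(Ω)`, `v ↦ (w ↦ (v, w))`. -/
def toDual (v : L2 Ω) : HMinusOne Ω := (innerSL ℝ v).comp toL2

/-- `h` is the weak partial derivative `∂_i g` on the open set `U`. -/
def IsWeakPDeriv (U : Set (Fin d → ℝ)) (i : Fin d) (g h : (Fin d → ℝ) → ℝ) : Prop :=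
  ∀ φ, IsTestFun U φ → (∫ x in U, g x * pderiv i φ x) = -(∫ x in U, h x * φ x)

/-! ### Meshes of `d`-rectangles -/

/-- A nondegenerate `d`-rectangle `∏_i [lo_i, hi_i]`. -/
structure Rect (d : ℕ) where
  lo : Fin d → ℝ
  hi : Fin d → ℝ
  lt : ∀ i, lo i < hi i

/-- The open rectangle. -/
def Rect.inner (K : Rect d) : Set (Fin d → ℝ) := Set.pi Set.univ fun i => Set.Ioo (K.lo i) (K.hi i)

/-- The closed rectangle. -/
def Rect.closed (K : Rect d) : Set (Fin d → ℝ) := Set.Icc K.lo K.hi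

/-- The Euclidean diameter. -/
def Rect.diam (K : Rect d) : ℝ := Real.sqrt (∑ i, (K.hi i - K.lo i) ^ 2)

/-- A decomposition of `Ω` into finitely many `d`-rectangles with disjoint interiors. -/
structure RectMesh (Ω : Set (Fin d → ℝ)) where
  elems : Finset (Rect d)
  inner_subset : ∀ K ∈ elems, K.inner ⊆ Ω
  cover : Ω ⊆ ⋃ K ∈ elems, K.closed
  disjoint : ∀ K ∈ elems, ∀ L ∈ elems, K ≠ L → Disjoint K.inner L.inner

/-- The mesh size `H`, the largest diameter of an element. -/
def RectMesh.size (𝒯 : RectMesh Ω) : ℝ := ⨆ K : 𝒯.elems, K.1.diam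

/-- Multi-indices of order at most `k`. -/
abbrev MultiIdx (d k : ℕ) : Type := {α : Fin d → Fin (k + 1) // ∑ i, (α i : ℕ) ≤ k}

/-- The multi-index `0`. -/
def MultiIdx.zero (d k : ℕ) : MultiIdx d k := ⟨fun _ => 0, by simp⟩

theorem integrable_mul_testFun {U : Set (Fin d → ℝ)} (hU : U ⊆ Ω) (g : L2 Ω)
    {φ : (Fin d → ℝ) → ℝ} (hc : Continuous φ) (hs : HasCompactSupport φ) :
    Integrable (fun x => g x * φ x) (volume.restrict U) := by
  have h1 : MemLp g 2 (volume.restrict U) :=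
    (Lp.memLp g).mono_measure (Measure.restrict_mono hU le_rfl)
  have h2 : MemLp φ 2 (volume.restrict U) :=
    (hc.memLp_of_hasCompactSupport hs).mono_measure Measure.restrict_le_self
  exact h1.integrable_mul h2

theorem integrable_mul_pderiv {U : Set (Fin d → ℝ)} (hU : U ⊆ Ω) (g : L2 Ω)
    {φ : (Fin d → ℝ) → ℝ} (hφ : IsTestFun U φ) (i : Fin d) :
    Integrable (fun x => g x * pderiv i φ x) (volume.restrict U) := by
  refine integrable_mul_testFun hU g ?_ ?_
  · exact (hφ.smooth.continuous_fderiv (by simp)).clm_apply continuous_const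
  · exact hφ.compact.fderiv_apply ℝ _

theorem ae_restrict_subset {U : Set (Fin d → ℝ)} (hU : U ⊆ Ω) {p : (Fin d → ℝ) → Prop}
    (h : ∀ᵐ x ∂(volume.restrict Ω), p x) : ∀ᵐ x ∂(volume.restrict U), p x :=
  ae_mono (Measure.restrict_mono hU le_rfl) h

/-- The broken Sobolev space `H^k(𝒯)`. A function `v` is represented by the family
`(∂^α v)_{|α| ≤ k}` of its elementwise weak derivatives, which lie in `L²(Ω)`; the function itself
is the entry at the multi-index `0`. The norm is
`(∑_{|α| ≤ k} ‖∂^α v‖²)^{1/2} = (∑_K ‖v‖²_{H^k(K)})^{1/2}`. -/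
def brokenSobolev (𝒯 : RectMesh Ω) (k : ℕ) : Submodule ℝ (PiLp 2 (fun _ : MultiIdx d k => L2 Ω)) where
  carrier := {g | ∀ K ∈ 𝒯.elems, ∀ (i : Fin d) (α β : MultiIdx d k),
    (∀ j, (β.1 j : ℕ) = α.1 j + if j = i then 1 else 0) → IsWeakPDeriv K.inner i (g α) (g β)}
  zero_mem' := by
    intro K hK i α β _ φ hφ
    have h : (⇑(0 : L2 Ω)) =ᵐ[volume.restrict K.inner] 0 :=
      ae_restrict_subset (𝒯.inner_subset K hK) (Lp.coeFn_zero ℝ 2 _)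
    have e1 : ∫ x in K.inner, (0 : L2 Ω) x * pderiv i φ x = 0 := by
      rw [integral_congr_ae (g := fun _ => 0)]
      · simp
      · filter_upwards [h] with x hx; rw [hx, Pi.zero_apply, zero_mul]
    have e2 : ∫ x in K.inner, (0 : L2 Ω) x * φ x = 0 := by
      rw [integral_congr_ae (g := fun _ => 0)]
      · simp
      · filter_upwards [h] with x hx; rw [hx, Pi.zero_apply, zero_mul]
    simp only [PiLp.zero_apply]
    rw [e1, e2, neg_zero]
  add_mem' := by
    intro g h hg hh K hK i α β hαβ φ hφ
    have hs := 𝒯.inner_subset K hK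
    have e1 : ∫ x in K.inner, (g α + h α) x * pderiv i φ x
        = (∫ x in K.inner, g α x * pderiv i φ x) + (∫ x in K.inner, h α x * pderiv i φ x) := by
      rw [← integral_add (integrable_mul_pderiv hs _ hφ i) (integrable_mul_pderiv hs _ hφ i)]
      refine integral_congr_ae ?_
      filter_upwards [ae_restrict_subset hs (Lp.coeFn_add (g α) (h α))] with x hx
      rw [hx, Pi.add_apply, add_mul]
    have e2 : ∫ x in K.inner, (g β + h β) x * φ x
        = (∫ x in K.inner, g β x * φ x) + (∫ x in K.inner, h β x * φ x) := by
      rw [← integral_add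
        (integrable_mul_testFun hs _ hφ.smooth.continuous hφ.compact)
        (integrable_mul_testFun hs _ hφ.smooth.continuous hφ.compact)]
      refine integral_congr_ae ?_
      filter_upwards [ae_restrict_subset hs (Lp.coeFn_add (g β) (h β))] with x hx
      rw [hx, Pi.add_apply, add_mul]
    simp only [PiLp.add_apply]
    rw [e1, e2, hg K hK i α β hαβ φ hφ, hh K hK i α β hαβ φ hφ, neg_add]
  smul_mem' := by
    intro c g hg K hK i α β hαβ φ hφ
    have hs := 𝒯.inner_subset K hK
    have e1 : ∫ x in K.inner, (c • g α) x * pderiv i φ x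
        = c * ∫ x in K.inner, g α x * pderiv i φ x := by
      rw [← integral_const_mul]
      refine integral_congr_ae ?_
      filter_upwards [ae_restrict_subset hs (Lp.coeFn_smul c (g α))] with x hx
      rw [hx, Pi.smul_apply, smul_eq_mul, mul_assoc]
    have e2 : ∫ x in K.inner, (c • g β) x * φ x = c * ∫ x in K.inner, g β x * φ x := by
      rw [← integral_const_mul]
      refine integral_congr_ae ?_
      filter_upwards [ae_restrict_subset hs (Lp.coeFn_smul c (g β))] with x hx
      rw [hx, Pi.smul_apply, smul_eq_mul, mul_assoc]
    simp only [PiLp.smul_apply]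
    rw [e1, e2, hg K hK i α β hαβ φ hφ, mul_neg]

/-- The function in `L²(Ω)` that underlies an element of `H^k(𝒯)`. -/
def brokenToL2 {𝒯 : RectMesh Ω} {k : ℕ} (g : brokenSobolev 𝒯 k) : L2 Ω :=
  (g : PiLp 2 (fun _ : MultiIdx d k => L2 Ω)) (MultiIdx.zero d k)

/-! ### The model problem -/

/-- A measurable coefficient with `a₀ ≤ A(x) ≤ b₀` for almost every `x ∈ Ω`. -/
structure IsCoefficient (Ω : Set (Fin d → ℝ)) (a₀ b₀ : ℝ) (A : (Fin d → ℝ) → ℝ) : Prop where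
  measurable : AEStronglyMeasurable A (volume.restrict Ω)
  bounds : ∀ᵐ x ∂(volume.restrict Ω), a₀ ≤ A x ∧ A x ≤ b₀

/-- `(A ∇u, ∇v)_{L²(S)}`. -/
def formOn (A : (Fin d → ℝ) → ℝ) (S : Set (Fin d → ℝ)) (u v : H10 Ω) : ℝ :=
  ∑ i, ∫ x in S, A x * grad i u x * grad i v x

/-- The bilinear form `a(u, v) = (A ∇u, ∇v)_{L²(Ω)}`. -/
def form (A : (Fin d → ℝ) → ℝ) (u v : H10 Ω) : ℝ := formOn A Ω u v

/-- The time derivative `∂_t u(t) ∈ H⁻¹(Ω)` on `[0, T]`, one-sided at the end points. -/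
def timeDeriv (T : ℝ) (u : ℝ → H10 Ω) (t : ℝ) : HMinusOne Ω :=
  derivWithin (fun s => toDual (toL2 (u s))) (Set.Icc 0 T) t

/-- `u` solves `⟨∂_t u, v⟩ + a(u, v) = (f, v)` for all `v ∈ H¹₀(Ω)` and all `t ∈ [0, T]`, with
`u(0) = u₀`. -/
structure IsWeakSolution (A : (Fin d → ℝ) → ℝ) (T : ℝ) (u₀ : H10 Ω) (f : ℝ → L2 Ω)
    (u : ℝ → H10 Ω) : Prop where
  init : u 0 = u₀
  diff : DifferentiableOn ℝ (fun s => toDual (toL2 (u s))) (Set.Icc 0 T)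
  eqn : ∀ t ∈ Set.Icc 0 T, ∀ v : H10 Ω, timeDeriv T u t v + form A (u t) v = toDual (f t) v

/-! ### The multiscale space -/

/-- The space `V_H` of functions that on each element are a polynomial of partial degree at
most `p`. -/
def polySpace (𝒯 : RectMesh Ω) (p : ℕ) : Submodule ℝ (L2 Ω) where
  carrier := {v | ∀ K ∈ 𝒯.elems, ∃ q : MvPolynomial (Fin d) ℝ, (∀ i, q.degreeOf i ≤ p) ∧
    v =ᵐ[volume.restrict K.inner] fun x => MvPolynomial.eval x q}
  zero_mem' := by
    intro K hK
    refine ⟨0, by simp, ?_⟩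
    filter_upwards [ae_restrict_subset (𝒯.inner_subset K hK) (Lp.coeFn_zero ℝ 2 _)] with x hx
    simpa using hx
  add_mem' := by
    intro v w hv hw K hK
    obtain ⟨q, hq, hvq⟩ := hv K hK
    obtain ⟨r, hr, hwr⟩ := hw K hK
    refine ⟨q + r, fun i => (MvPolynomial.degreeOf_add_le i q r).trans (max_le (hq i) (hr i)), ?_⟩
    filter_upwards [ae_restrict_subset (𝒯.inner_subset K hK) (Lp.coeFn_add v w), hvq, hwr]
      with x hx h1 h2
    rw [hx, Pi.add_apply, h1, h2, map_add]
  smul_mem' := by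
    intro c v hv K hK
    obtain ⟨q, hq, hvq⟩ := hv K hK
    refine ⟨MvPolynomial.C c * q,
      fun i => (MvPolynomial.degreeOf_C_mul_le q i c).trans (hq i), ?_⟩
    filter_upwards [ae_restrict_subset (𝒯.inner_subset K hK) (Lp.coeFn_smul c v), hvq] with x hx h1
    rw [hx, Pi.smul_apply, h1, smul_eq_mul, map_mul, MvPolynomial.eval_C]

theorem ae_of_forall_inner (𝒯 : RectMesh Ω) {P : (Fin d → ℝ) → Prop}
    (h : ∀ K ∈ 𝒯.elems, ∀ᵐ x ∂(volume.restrict K.inner), P x) :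
    ∀ᵐ x ∂(volume.restrict Ω), P x := by
  have hK : ∀ K ∈ 𝒯.elems, ∀ᵐ x ∂(volume.restrict K.closed), P x := by
    intro K hK
    have e : K.inner =ᵐ[volume] K.closed :=
      Measure.univ_pi_Ioo_ae_eq_Icc (μ := fun _ : Fin d => (volume : Measure ℝ))
        (f := K.lo) (g := K.hi)
    rw [← Measure.restrict_congr_set e]
    exact h K hK
  have hU : ∀ᵐ x ∂(volume.restrict (⋃ K ∈ 𝒯.elems, K.closed)), P x := by
    rw [ae_restrict_biUnion_finset_iff]
    exact hK
  exact ae_mono (Measure.restrict_mono 𝒯.cover le_rfl) hU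

/-- Restriction of `L²(Ω)` to an open element, as classes of measurable functions. -/
def restrictInner (𝒯 : RectMesh Ω) (K : 𝒯.elems) :
    L2 Ω →ₗ[ℝ] ((Fin d → ℝ) →ₘ[volume.restrict K.1.inner] ℝ) where
  toFun v := AEEqFun.mk v ((Lp.aestronglyMeasurable v).mono_measure
    (Measure.restrict_mono (𝒯.inner_subset K.1 K.2) le_rfl))
  map_add' v w := by
    rw [AEEqFun.mk_add_mk, AEEqFun.mk_eq_mk]
    exact ae_restrict_subset (𝒯.inner_subset K.1 K.2) (Lp.coeFn_add v w)
  map_smul' c v := by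
    rw [RingHom.id_apply, AEEqFun.smul_mk, AEEqFun.mk_eq_mk]
    exact ae_restrict_subset (𝒯.inner_subset K.1 K.2) (Lp.coeFn_smul c v)

/-- Polynomials as classes of measurable functions. -/
def polyClass (d : ℕ) (μ : Measure (Fin d → ℝ)) :
    MvPolynomial (Fin d) ℝ →ₗ[ℝ] ((Fin d → ℝ) →ₘ[μ] ℝ) where
  toFun q := AEEqFun.mk (fun x => MvPolynomial.eval x q)
    (MvPolynomial.continuous_eval q).aestronglyMeasurable
  map_add' q r := by
    rw [AEEqFun.mk_add_mk, AEEqFun.mk_eq_mk]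
    exact Filter.Eventually.of_forall fun x => by simp
  map_smul' c q := by
    rw [RingHom.id_apply, AEEqFun.smul_mk, AEEqFun.mk_eq_mk]
    exact Filter.Eventually.of_forall fun x => by simp

instance restrictDegree_finite (d p : ℕ) :
    Module.Finite ℝ (MvPolynomial.restrictDegree (Fin d) ℝ p) := by
  have hs : {n : Fin d →₀ ℕ | ∀ i, n i ≤ p}.Finite := by
    refine (Set.finite_Iic (Finsupp.equivFunOnFinite.symm fun _ : Fin d => p)).subset ?_
    intro n hn i
    exact hn i
  have : Finite {n : Fin d →₀ ℕ | ∀ i, n i ≤ p} := hs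
  exact Module.Finite.of_basis
    (MvPolynomial.basisRestrictSupport ℝ {n : Fin d →₀ ℕ | ∀ i, n i ≤ p})

instance polySpace_finiteDimensional (𝒯 : RectMesh Ω) (p : ℕ) :
    FiniteDimensional ℝ (polySpace 𝒯 p) := by
  let S : ∀ K : 𝒯.elems, Submodule ℝ ((Fin d → ℝ) →ₘ[volume.restrict K.1.inner] ℝ) := fun K =>
    (MvPolynomial.restrictDegree (Fin d) ℝ p).map (polyClass d (volume.restrict K.1.inner))
  have hfin : ∀ K, Module.Finite ℝ (S K) := fun K => inferInstance
  have hmem : ∀ (K : 𝒯.elems) (v : polySpace 𝒯 p), restrictInner 𝒯 K (v : L2 Ω) ∈ S K := by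
    intro K v
    obtain ⟨q, hq, hvq⟩ := v.2 K.1 K.2
    refine ⟨q, ?_, ?_⟩
    · rw [SetLike.mem_coe, MvPolynomial.mem_restrictDegree]
      intro s hs i
      exact (MvPolynomial.le_degreeOf_of_mem_support i hs).trans (hq i)
    · exact AEEqFun.mk_eq_mk.2 hvq.symm
  let Φ : polySpace 𝒯 p →ₗ[ℝ] (∀ K, S K) := LinearMap.pi fun K =>
    LinearMap.codRestrict (S K) ((restrictInner 𝒯 K).comp (polySpace 𝒯 p).subtype) (hmem K)
  refine Module.Finite.of_injective Φ ?_
  intro v w hvw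
  apply Subtype.ext
  apply Lp.ext
  refine ae_of_forall_inner 𝒯 fun K hK => ?_
  have h := congrArg Subtype.val (congrFun hvw ⟨K, hK⟩)
  exact AEEqFun.mk_eq_mk.1 h

/-- The `L²`-projection `Π` onto `V_H`. -/
def polyProj (𝒯 : RectMesh Ω) (p : ℕ) (v : L2 Ω) : polySpace 𝒯 p :=
  (polySpace 𝒯 p).orthogonalProjectionOnto v

/-- The space `W`, the kernel of `Π` in `H¹₀(Ω)`. -/
def fineSpace (𝒯 : RectMesh Ω) (p : ℕ) : Set (H10 Ω) := {w | polyProj 𝒯 p (toL2 w) = 0}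

/-- The continuous functions with zero trace that are piecewise affine in each variable. -/
def affineZero (𝒯 : RectMesh Ω) : Submodule ℝ (H10 Ω) where
  carrier := {w | toL2 w ∈ polySpace 𝒯 1 ∧ ∃ g : (Fin d → ℝ) → ℝ,
    ContinuousOn g (closure Ω) ∧ toL2 w =ᵐ[volume.restrict Ω] g}
  zero_mem' := by
    refine ⟨by simp, fun _ => 0, continuousOn_const, ?_⟩
    rw [map_zero]; exact Lp.coeFn_zero ℝ 2 _
  add_mem' := by
    rintro v w ⟨hv, g, hg, hvg⟩ ⟨hw, h, hh, hwh⟩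
    refine ⟨by rw [map_add]; exact add_mem hv hw, fun x => g x + h x, hg.add hh, ?_⟩
    rw [map_add]
    filter_upwards [Lp.coeFn_add (toL2 v) (toL2 w), hvg, hwh] with x hx h1 h2
    rw [hx, Pi.add_apply, h1, h2]
  smul_mem' := by
    rintro c v ⟨hv, g, hg, hvg⟩
    refine ⟨by rw [map_smul]; exact Submodule.smul_mem _ c hv, fun x => c * g x,
      continuousOn_const.mul hg, ?_⟩
    rw [map_smul]
    filter_upwards [Lp.coeFn_smul c (toL2 v), hvg] with x hx h1
    rw [hx, Pi.smul_apply, h1, smul_eq_mul]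

/-- `B` is a bubble operator: it maps every `v ∈ V_H` that vanishes outside an element `K` to a
function in `H¹₀(K)` with the same `L²`-projection. (To give such a linear map is to
choose one bubble function in `H¹₀(K)` for each member of a basis, such as that of the Legendre
polynomials, of the polynomials on each element `K`.) -/
def IsBubbleOperator (𝒯 : RectMesh Ω) (p : ℕ) (B : polySpace 𝒯 p →ₗ[ℝ] H10 Ω) : Prop :=
  ∀ K ∈ 𝒯.elems, ∀ v : polySpace 𝒯 p,
    (∀ L ∈ 𝒯.elems, L ≠ K → (v : L2 Ω) =ᵐ[volume.restrict L.inner] 0) →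
    (B v : GradPair Ω) ∈ sobolevZero Ω K.inner ∧
      ∀ q ∈ polySpace 𝒯 p, inner ℝ (toL2 (B v)) q = inner ℝ (v : L2 Ω) q

/-- The quasi-interpolation `I = E ∘ π`: the `L²`-projection `π` onto piecewise constants, followed
by a linear map `E` from piecewise constant functions to continuous piecewise affine functions with
zero trace. The usual choice of `E` averages the values of the adjacent elements at each interior
vertex. -/
def quasiInterp (𝒯 : RectMesh Ω) (E : polySpace 𝒯 0 →ₗ[ℝ] affineZero 𝒯) (v : L2 Ω) : H10 Ω :=
  E (polyProj 𝒯 0 v)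

/-- The operator `v ↦ I v + B Π (v - I v)`. -/
def stabInterp (𝒯 : RectMesh Ω) (p : ℕ) (E : polySpace 𝒯 0 →ₗ[ℝ] affineZero 𝒯)
    (B : polySpace 𝒯 p →ₗ[ℝ] H10 Ω) (v : L2 Ω) : H10 Ω :=
  quasiInterp 𝒯 E v + B (polyProj 𝒯 p (v - toL2 (quasiInterp 𝒯 E v)))

/-- The stabilized bubble space `U_H`, the image of `V_H` under `stabInterp`. -/
def bubbleSpace (𝒯 : RectMesh Ω) (p : ℕ) (E : polySpace 𝒯 0 →ₗ[ℝ] affineZero 𝒯)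
    (B : polySpace 𝒯 p →ₗ[ℝ] H10 Ω) : Set (H10 Ω) :=
  {z | ∃ v ∈ polySpace 𝒯 p, z = stabInterp 𝒯 p E B v}

/-- `c = C_K v` for the global element correction `C_K : H¹₀(Ω) → W` of the element `K`:
`a(C_K v, w) = (A ∇v, ∇w)_{L²(K)}` for all `w ∈ W`. -/
def IsElementCorrection (𝒯 : RectMesh Ω) (p : ℕ) (A : (Fin d → ℝ) → ℝ) (K : Rect d)
    (v c : H10 Ω) : Prop :=
  c ∈ fineSpace 𝒯 p ∧ ∀ w ∈ fineSpace 𝒯 p, form A c w = formOn A K.inner v w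

/-- `c = C v` for the global correction `C = ∑_K C_K`. -/
def IsCorrection (𝒯 : RectMesh Ω) (p : ℕ) (A : (Fin d → ℝ) → ℝ) (v c : H10 Ω) : Prop :=
  ∃ cK : Rect d → H10 Ω, (∀ K ∈ 𝒯.elems, IsElementCorrection 𝒯 p A K v (cK K)) ∧
    c = ∑ K ∈ 𝒯.elems, cK K

/-- The multiscale space `(1 - C) U_H`. -/
def multiscaleSpace (𝒯 : RectMesh Ω) (p : ℕ) (A : (Fin d → ℝ) → ℝ)
    (E : polySpace 𝒯 0 →ₗ[ℝ] affineZero 𝒯) (B : polySpace 𝒯 p →ₗ[ℝ] H10 Ω) : Set (H10 Ω) :=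
  {z | ∃ v ∈ bubbleSpace 𝒯 p E B, ∃ c, IsCorrection 𝒯 p A v c ∧ z = v - c}

/-- `q` is the projection of `v` into the multiscale space `V`, orthogonal with respect to `a`. -/
def IsMultiscaleProj (A : (Fin d → ℝ) → ℝ) (V : Set (H10 Ω)) (v q : H10 Ω) : Prop :=
  q ∈ V ∧ ∀ z ∈ V, form A q z = form A v z

/-- `e = D F` for the enriched correction operator: `e ∈ W` and `a(e, w) = -⟨F, w⟩` for all `w ∈ W`.
For `F = toDual v` with `v ∈ L²(Ω)`, the right-hand side is `-(v, w)`. -/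
def IsEnrichedCorrection (𝒯 : RectMesh Ω) (p : ℕ) (A : (Fin d → ℝ) → ℝ) (F : HMinusOne Ω)
    (e : H10 Ω) : Prop :=
  e ∈ fineSpace 𝒯 p ∧ ∀ w ∈ fineSpace 𝒯 p, form A e w = -F w

end MultiscaleHeat

end

/-!
The multiscale space is the `a`-orthogonal complement of the fine space `W`: the bubble operator
makes `𝒳` preserve the projection onto `V_H`, so every function differs from an element of `U_H`
by an element of `W`. Hence `u - P̃ u ∈ W`, and `z = u - (P̃ u + D(∂ₜu))` is the element of `W`
with `a(z, w) = (f, w)` for all `w ∈ W`. Orthogonality of `z` to `V_H` is then used twice in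
`α ‖∇z‖² ≤ (f, z)`: on one side `(f, z) = (f - r, z)` with `r ∈ V_H`, which the Bramble–Hilbert
lemma bounds by `H^{p+1} ‖z‖`, on the other side `‖z‖ ≤ C H ‖∇z‖` by the Poincaré inequality for
functions orthogonal to the piecewise constants.

Both estimates are the same statement about one box, proved with the tensor Legendre basis. A
product of Legendre polynomials of degree at least `m` in `x_i` is the `m`-th derivative in `x_i`
of a polynomial that vanishes to order `m` on the faces `x_i = lo_i` and `x_i = hi_i`, so that
integration by parts and the one-dimensional Poincaré inequality bound the corresponding part of
`f` by `∂_i^m f`. This uses only the pure derivatives of `f`.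
-/

noncomputable section

namespace MultiscaleHeat

open Filter Topology
open scoped InnerProductSpace
open MvPolynomial (eval)

variable {d : ℕ} {i : Fin d}

theorem norm_le_iSup_norm {X Y : Type*} [TopologicalSpace X] [SeminormedAddCommGroup Y] {s : Set X}
    {f : X → Y} (hs : IsCompact s) (hf : ContinuousOn f s) {t : X} (ht : t ∈ s) :
    ‖f t‖ ≤ ⨆ x : s, ‖f x‖ :=
  le_ciSup (f := fun x : s => ‖f x‖)
    (image_eq_range (‖f ·‖) s ▸ hs.bddAbove_image hf.norm) ⟨t, ht⟩

/-! ### Smooth functions, polynomials and test functions -/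

section Cutoff

variable {U : Set (Fin d → ℝ)} {φ ψ : (Fin d → ℝ) → ℝ}

theorem contDiff_pderiv (i : Fin d) (hφ : ContDiff ℝ ∞ φ) : ContDiff ℝ ∞ (pderiv i φ) :=
  (hφ.fderiv_right (m := ∞) (by simp)).clm_apply contDiff_const

theorem pderiv_mul {x : Fin d → ℝ} (hφ : DifferentiableAt ℝ φ x) (hψ : DifferentiableAt ℝ ψ x) :
    pderiv i (fun x => φ x * ψ x) x = φ x * pderiv i ψ x + pderiv i φ x * ψ x := by
  simp only [pderiv, fderiv_fun_mul hφ hψ, add_apply, smul_apply, smul_eq_mul, mul_comm (ψ x)]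

theorem pderiv_comp {g : ℝ → ℝ} {x : Fin d → ℝ} (hg : DifferentiableAt ℝ g (φ x))
    (hφ : DifferentiableAt ℝ φ x) :
    pderiv i (fun x => g (φ x)) x = deriv g (φ x) * pderiv i φ x := by
  simp only [pderiv]
  rw [← Function.comp_def g φ, (hg.hasDerivAt.comp_hasFDerivAt x hφ.hasFDerivAt).fderiv,
    smul_apply, smul_eq_mul]

theorem contDiff_eval (q : MvPolynomial (Fin d) ℝ) : ContDiff ℝ ∞ fun x => eval x q :=
  (AnalyticOnNhd.eval_mvPolynomial (𝕜 := ℝ) q).contDiff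

theorem differentiable_eval (q : MvPolynomial (Fin d) ℝ) :
    Differentiable ℝ fun x : Fin d → ℝ => eval x q :=
  (contDiff_eval q).differentiable (by simp)

theorem pderiv_eval (i : Fin d) (q : MvPolynomial (Fin d) ℝ) :
    pderiv i (fun x => eval x q) = fun x => eval x (MvPolynomial.pderiv i q) := by
  funext x
  induction q using MvPolynomial.induction_on with
  | C a => simp [pderiv]
  | add q r hq hr =>
    simp only [pderiv, map_add] at *
    rw [fderiv_fun_add (differentiable_eval q x) (differentiable_eval r x), add_apply, hq, hr]
  | mul_X q j hq =>
    have hX : pderiv i (fun x : Fin d → ℝ => x j) x = (Pi.single i 1 : Fin d → ℝ) j := by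
      rw [pderiv, (hasFDerivAt_apply j x).fderiv]
      rfl
    simp only [map_mul, MvPolynomial.eval_X]
    rw [pderiv_mul (differentiable_eval q x) (differentiableAt_apply j x), hq, hX]
    rcases eq_or_ne j i with rfl | h
    · simp [mul_comm]
    · simp [h, mul_comm]

theorem IsTestFun.eq_zero (hφ : IsTestFun U φ) {x : Fin d → ℝ} (hx : x ∉ U) : φ x = 0 :=
  image_eq_zero_of_notMem_tsupport fun h => hx (hφ.supp h)

theorem IsTestFun.pderiv (hφ : IsTestFun U φ) (i : Fin d) : IsTestFun U (pderiv i φ) where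
  smooth := contDiff_pderiv i hφ.smooth
  compact := hφ.compact.fderiv_apply ℝ _
  supp := (tsupport_fderiv_apply_subset ℝ _).trans hφ.supp

theorem IsTestFun.contDiff_mul (hφ : IsTestFun U φ) (hψ : ContDiff ℝ ∞ ψ) :
    IsTestFun U fun x => ψ x * φ x where
  smooth := hψ.mul hφ.smooth
  compact := hφ.compact.mul_left
  supp := (tsupport_mul_subset_right (f := ψ) (g := φ)).trans hφ.supp

theorem IsTestFun.integrable (hφ : IsTestFun U φ) : Integrable φ :=
  hφ.smooth.continuous.integrable_of_hasCompactSupport hφ.compact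

theorem isWeakPDeriv_of_contDiff (i : Fin d) (hψ : ContDiff ℝ ∞ ψ) :
    IsWeakPDeriv U i ψ (pderiv i ψ) := by
  intro φ hφ
  rw [setIntegral_eq_integral_of_forall_compl_eq_zero
      fun x hx => by rw [(hφ.pderiv i).eq_zero hx, mul_zero],
    setIntegral_eq_integral_of_forall_compl_eq_zero fun x hx => by rw [hφ.eq_zero hx, mul_zero]]
  exact integral_mul_fderiv_eq_neg_fderiv_mul_of_integrable
    (hφ.contDiff_mul (contDiff_pderiv i hψ)).integrable
    ((hφ.pderiv i).contDiff_mul hψ).integrable (hφ.contDiff_mul hψ).integrable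
    (fun x _ => hψ.differentiable (by simp) x) (fun x _ => hφ.smooth.differentiable (by simp) x)

/-! ### Rectangles -/

theorem Rect.isOpen_inner (K : Rect d) : IsOpen K.inner :=
  isOpen_set_pi finite_univ fun _ _ => isOpen_Ioo

theorem Rect.measurableSet_inner (K : Rect d) : MeasurableSet K.inner :=
  K.isOpen_inner.measurableSet

theorem Rect.inner_subset_closed (K : Rect d) : K.inner ⊆ K.closed := fun _ hx =>
  ⟨fun i => (hx i trivial).1.le, fun i => (hx i trivial).2.le⟩

theorem Rect.isCompact_closed (K : Rect d) : IsCompact K.closed := isCompact_Icc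

instance Rect.isFiniteMeasure_inner (K : Rect d) : IsFiniteMeasure (volume.restrict K.inner) :=
  isFiniteMeasure_restrict.2
    ((measure_mono K.inner_subset_closed).trans_lt K.isCompact_closed.measure_lt_top).ne

theorem Rect.exists_bound (K : Rect d) (hφ : Continuous φ) : ∃ M, ∀ x ∈ K.inner, |φ x| ≤ M := by
  obtain ⟨M, hM⟩ := K.isCompact_closed.exists_bound_of_continuousOn hφ.continuousOn
  exact ⟨M, fun x hx => hM x (K.inner_subset_closed hx)⟩

theorem Rect.memLp_of_continuous (K : Rect d) (hφ : Continuous φ) :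
    MemLp φ 2 (volume.restrict K.inner) := by
  obtain ⟨M, hM⟩ := K.exists_bound hφ
  exact MemLp.of_bound hφ.aestronglyMeasurable M
    (ae_restrict_of_forall_mem K.measurableSet_inner hM)

/-- The polynomial `(x_i - lo_i)(hi_i - x_i)`, which is positive in the open rectangle and vanishes
on the two faces orthogonal to `e_i`. -/
def Rect.edge (K : Rect d) (i : Fin d) : MvPolynomial (Fin d) ℝ :=
  (MvPolynomial.X i - MvPolynomial.C (K.lo i)) * (MvPolynomial.C (K.hi i) - MvPolynomial.X i)

theorem Rect.eval_edge (K : Rect d) (i : Fin d) (x : Fin d → ℝ) :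
    eval x (K.edge i) = (x i - K.lo i) * (K.hi i - x i) := by
  simp [Rect.edge]

theorem Rect.pderiv_edge_of_ne (K : Rect d) {j : Fin d} (hij : i ≠ j) :
    MvPolynomial.pderiv i (K.edge j) = 0 := by
  simp [Rect.edge, MvPolynomial.pderiv_X_of_ne hij.symm]

theorem Rect.mem_inner_iff (K : Rect d) {x : Fin d → ℝ} :
    x ∈ K.inner ↔ ∀ i, 0 < eval x (K.edge i) := by
  simp only [Rect.inner, Set.mem_pi, mem_univ, true_implies, mem_Ioo, K.eval_edge]
  refine forall_congr' fun i => ⟨fun h => mul_pos (by linarith) (by linarith), fun h => ?_⟩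
  have := K.lt i
  constructor <;> nlinarith

/-! ### Cutoff functions and integration by parts on a rectangle -/

/-- A smooth step that vanishes on `(-∞, 1]` and equals `1` on `[2, ∞)`, the profile of the cutoff
functions. -/
def step (y : ℝ) : ℝ := Real.smoothTransition (y - 1)

theorem contDiff_step : ContDiff ℝ ∞ step :=
  Real.smoothTransition.contDiff.comp (contDiff_id.sub contDiff_const)

theorem step_eq_zero {y : ℝ} (h : y ≤ 1) : step y = 0 :=
  Real.smoothTransition.zero_of_nonpos (by linarith)

theorem step_eq_one {y : ℝ} (h : 2 ≤ y) : step y = 1 :=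
  Real.smoothTransition.one_of_one_le (by linarith)

theorem abs_step_le_one (y : ℝ) : |step y| ≤ 1 := by
  rw [step, abs_of_nonneg (Real.smoothTransition.nonneg _)]
  exact Real.smoothTransition.le_one _

theorem deriv_step_eq_zero {y : ℝ} (h : 2 < y) : deriv step y = 0 := by
  have : step =ᶠ[𝓝 y] fun _ => 1 := by
    filter_upwards [lt_mem_nhds h] with z hz using step_eq_one hz.le
  rw [this.deriv_eq, deriv_const]

theorem exists_bound_mul_deriv_step : ∃ M, ∀ y, 0 ≤ y → |y * deriv step y| ≤ M := by
  have hcont : Continuous fun y => y * deriv step y :=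
    continuous_id.mul (contDiff_step.continuous_deriv (by simp))
  obtain ⟨M, hM⟩ := (isCompact_Icc (a := (0 : ℝ)) (b := 2)).exists_bound_of_continuousOn
    hcont.continuousOn
  refine ⟨M, fun y hy => ?_⟩
  rcases le_or_gt y 2 with h | h
  · exact hM y ⟨hy, h⟩
  · rw [deriv_step_eq_zero h, mul_zero, abs_zero]
    exact (norm_nonneg _).trans (hM 0 (by simp))

/-- The cutoff function of a rectangle with respect to the faces orthogonal to the directions in
`s`. As `N` grows it tends to `1` inside the rectangle. -/
def Rect.cutoff (K : Rect d) (s : Finset (Fin d)) (N : ℝ) (x : Fin d → ℝ) : ℝ :=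
  ∏ j ∈ s, step (N * eval x (K.edge j))

theorem Rect.contDiff_cutoff (K : Rect d) (s : Finset (Fin d)) (N : ℝ) :
    ContDiff ℝ ∞ (K.cutoff s N) :=
  contDiff_prod fun _ _ => contDiff_step.comp (contDiff_const.mul (contDiff_eval _))

theorem Rect.abs_cutoff_le_one (K : Rect d) (s : Finset (Fin d)) (N : ℝ) (x : Fin d → ℝ) :
    |K.cutoff s N x| ≤ 1 := by
  rw [Rect.cutoff, Finset.abs_prod]
  exact Finset.prod_le_one (fun _ _ => abs_nonneg _) fun _ _ => abs_step_le_one _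

theorem Rect.isTestFun_cutoff (K : Rect d) {N : ℝ} (hN : 0 < N) :
    IsTestFun K.inner (K.cutoff Finset.univ N) := by
  have hclosed : IsClosed {x | ∀ j, 1 ≤ N * eval x (K.edge j)} := by
    rw [ofPred_forall]
    exact isClosed_iInter fun j =>
      isClosed_le continuous_const (continuous_const.mul (MvPolynomial.continuous_eval _))
  have hsub : {x | ∀ j, 1 ≤ N * eval x (K.edge j)} ⊆ K.inner := fun x hx =>
    K.mem_inner_iff.2 fun j => pos_of_mul_pos_right (one_pos.trans_le (hx j)) hN.le
  have hsupp : tsupport (K.cutoff Finset.univ N) ⊆ {x | ∀ j, 1 ≤ N * eval x (K.edge j)} := by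
    refine closure_minimal (fun x hx j => ?_) hclosed
    by_contra! h
    exact hx (Finset.prod_eq_zero (Finset.mem_univ j) (step_eq_zero h.le))
  exact ⟨K.contDiff_cutoff _ _, K.isCompact_closed.of_isClosed_subset (isClosed_tsupport _)
    (hsupp.trans (hsub.trans K.inner_subset_closed)), hsupp.trans hsub⟩

theorem differentiable_step_eval (N : ℝ) (q : MvPolynomial (Fin d) ℝ) :
    Differentiable ℝ fun x : Fin d → ℝ => step (N * eval x q) :=
  (contDiff_step.differentiable (by simp)).comp ((differentiable_eval q).const_mul N)

theorem pderiv_step_eval (i : Fin d) (N : ℝ) (q : MvPolynomial (Fin d) ℝ) (x : Fin d → ℝ) :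
    pderiv i (fun x => step (N * eval x q)) x =
      deriv step (N * eval x q) * (N * eval x (MvPolynomial.pderiv i q)) := by
  have h : (fun x => N * eval x q) = fun x => eval x (MvPolynomial.C N * q) := by simp
  rw [pderiv_comp (φ := fun x => N * eval x q) (contDiff_step.differentiable (by simp) _)
    ((differentiable_eval q x).const_mul N), h, pderiv_eval]
  simp

theorem Rect.pderiv_cutoff_of_notMem (K : Rect d) {s : Finset (Fin d)} (hi : i ∉ s) (N : ℝ)
    (x : Fin d → ℝ) : pderiv i (K.cutoff s N) x = 0 := by
  induction s using Finset.induction_on with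
  | empty =>
    have hone : K.cutoff ∅ N = fun _ => 1 := rfl
    simp [pderiv, hone]
  | insert j s hj ih =>
    have hij : i ≠ j := fun h => hi (h ▸ Finset.mem_insert_self i s)
    have hprod : K.cutoff (insert j s) N = fun x => step (N * eval x (K.edge j)) * K.cutoff s N x :=
      funext fun x => Finset.prod_insert hj
    rw [hprod, pderiv_mul (differentiable_step_eval N _ x)
      ((K.contDiff_cutoff s N).differentiable (by simp) x), pderiv_step_eval,
      K.pderiv_edge_of_ne hij, ih fun h => hi (Finset.mem_insert_of_mem h)]
    simp

theorem Rect.pderiv_cutoff (K : Rect d) (i : Fin d) (N : ℝ) (x : Fin d → ℝ) :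
    pderiv i (K.cutoff Finset.univ N) x = deriv step (N * eval x (K.edge i)) *
      (N * eval x (MvPolynomial.pderiv i (K.edge i))) * K.cutoff (Finset.univ.erase i) N x := by
  have hprod : K.cutoff Finset.univ N =
      fun x => step (N * eval x (K.edge i)) * K.cutoff (Finset.univ.erase i) N x :=
    funext fun x => (Finset.mul_prod_erase _ _ (Finset.mem_univ i)).symm
  rw [hprod, pderiv_mul (differentiable_step_eval N _ x)
    ((K.contDiff_cutoff _ N).differentiable (by simp) x), pderiv_step_eval,
    K.pderiv_cutoff_of_notMem (Finset.notMem_erase i _), mul_zero, zero_add]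

theorem Rect.pderiv_cutoff_mul_edge_mul (K : Rect d) (i : Fin d) (G : MvPolynomial (Fin d) ℝ)
    (N : ℝ) (x : Fin d → ℝ) :
    pderiv i (fun x => K.cutoff Finset.univ N x * eval x (K.edge i * G)) x =
      K.cutoff Finset.univ N x * eval x (MvPolynomial.pderiv i (K.edge i * G)) +
        N * eval x (K.edge i) * deriv step (N * eval x (K.edge i)) *
          K.cutoff (Finset.univ.erase i) N x *
            eval x (MvPolynomial.pderiv i (K.edge i) * G) := by
  rw [pderiv_mul ((K.contDiff_cutoff _ N).differentiable (by simp) x) (differentiable_eval _ x),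
    pderiv_eval, K.pderiv_cutoff]
  simp only [map_mul]
  ring

theorem Rect.eventually_two_lt (K : Rect d) {x : Fin d → ℝ} (hx : x ∈ K.inner) :
    ∀ᶠ N : ℝ in atTop, ∀ j, 2 < N * eval x (K.edge j) :=
  eventually_all.2 fun j =>
    (tendsto_id.atTop_mul_const (K.mem_inner_iff.1 hx j)).eventually_gt_atTop 2

theorem Rect.eventually_cutoff_eq_one (K : Rect d) {x : Fin d → ℝ} (hx : x ∈ K.inner) :
    ∀ᶠ N : ℝ in atTop, K.cutoff Finset.univ N x = 1 := by
  filter_upwards [K.eventually_two_lt hx] with N hN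
  exact Finset.prod_eq_one fun j _ => step_eq_one (hN j).le

/-- The derivative of the cutoff is of order `N` where the distance to the face is of order `1 / N`,
and there `K.edge i` is of order `1 / N`. -/
theorem Rect.exists_bound_pderiv_cutoff_mul (K : Rect d) (i : Fin d)
    (G : MvPolynomial (Fin d) ℝ) : ∃ M, ∀ N : ℝ, 0 ≤ N → ∀ x ∈ K.inner,
      |pderiv i (fun x => K.cutoff Finset.univ N x * eval x (K.edge i * G)) x| ≤ M := by
  obtain ⟨M₁, hM₁⟩ := K.exists_bound
    (MvPolynomial.continuous_eval (MvPolynomial.pderiv i (K.edge i * G)))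
  obtain ⟨M₂, hM₂⟩ := exists_bound_mul_deriv_step
  obtain ⟨M₃, hM₃⟩ := K.exists_bound
    (MvPolynomial.continuous_eval (MvPolynomial.pderiv i (K.edge i) * G))
  refine ⟨1 * M₁ + M₂ * 1 * M₃, fun N hN x hx => ?_⟩
  have hedge := (K.mem_inner_iff.1 hx i).le
  have hM₂x := hM₂ (N * eval x (K.edge i)) (by positivity)
  have hM₂' : 0 ≤ M₂ := (abs_nonneg _).trans hM₂x
  rw [K.pderiv_cutoff_mul_edge_mul]
  refine (abs_add_le _ _).trans (add_le_add ?_ ?_)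
  · rw [abs_mul]
    exact mul_le_mul (K.abs_cutoff_le_one _ _ _) (hM₁ x hx) (abs_nonneg _) zero_le_one
  · rw [abs_mul, abs_mul _ (K.cutoff _ _ _)]
    exact mul_le_mul (mul_le_mul hM₂x (K.abs_cutoff_le_one _ _ _) (abs_nonneg _) hM₂')
      (hM₃ x hx) (abs_nonneg _) (by positivity)

theorem Rect.tendsto_pderiv_cutoff_mul (K : Rect d) (i : Fin d) (G : MvPolynomial (Fin d) ℝ)
    {x : Fin d → ℝ} (hx : x ∈ K.inner) :
    Tendsto (fun N => pderiv i (fun x => K.cutoff Finset.univ N x * eval x (K.edge i * G)) x)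
      atTop (𝓝 (eval x (MvPolynomial.pderiv i (K.edge i * G)))) := by
  refine tendsto_const_nhds.congr' ?_
  filter_upwards [K.eventually_cutoff_eq_one hx, K.eventually_two_lt hx] with N hone hN
  rw [K.pderiv_cutoff_mul_edge_mul, hone, deriv_step_eq_zero (hN i)]
  ring

theorem tendsto_integral_mul_of_bounded {X ι : Type*} [MeasurableSpace X] {μ : Measure X}
    {l : Filter ι} [l.IsCountablyGenerated] {v w : X → ℝ} {g : ι → X → ℝ} {M : ℝ}
    (hv : Integrable v μ) (hg : ∀ᶠ n in l, AEStronglyMeasurable (g n) μ)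
    (hM : ∀ᶠ n in l, ∀ᵐ x ∂μ, |g n x| ≤ M) (hlim : ∀ᵐ x ∂μ, Tendsto (g · x) l (𝓝 (w x))) :
    Tendsto (fun n => ∫ x, v x * g n x ∂μ) l (𝓝 (∫ x, v x * w x ∂μ)) := by
  refine tendsto_integral_filter_of_dominated_convergence (fun x => |v x| * M) ?_ ?_
    (hv.abs.mul_const M) ?_
  · filter_upwards [hg] with n hn using hv.aestronglyMeasurable.mul hn
  · filter_upwards [hM] with n hn
    filter_upwards [hn] with x hx
    rw [Real.norm_eq_abs, abs_mul]
    exact mul_le_mul_of_nonneg_left hx (abs_nonneg _)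
  · filter_upwards [hlim] with x hx using hx.const_mul (v x)

/-- Test with `K.cutoff univ N * G` and let `N → ∞`: the factor `K.edge i` of `G` keeps the
derivatives of these test functions bounded, so that dominated convergence applies. -/
theorem IsWeakPDeriv.integral_mul_pderiv {K : Rect d} {v w : (Fin d → ℝ) → ℝ}
    (h : IsWeakPDeriv K.inner i v w) (hv : Integrable v (volume.restrict K.inner))
    (hw : Integrable w (volume.restrict K.inner)) {G : MvPolynomial (Fin d) ℝ}
    (hG : K.edge i ∣ G) :
    ∫ x in K.inner, v x * eval x (MvPolynomial.pderiv i G) =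
      -∫ x in K.inner, w x * eval x G := by
  obtain ⟨G, rfl⟩ := hG
  have hsmooth : ∀ N, ContDiff ℝ ∞ fun x => K.cutoff Finset.univ N x * eval x (K.edge i * G) :=
    fun N => (K.contDiff_cutoff _ N).mul (contDiff_eval _)
  obtain ⟨M₁, hM₁⟩ := K.exists_bound_pderiv_cutoff_mul i G
  obtain ⟨M₂, hM₂⟩ := K.exists_bound (MvPolynomial.continuous_eval (K.edge i * G))
  have hlhs : Tendsto (fun N => ∫ x in K.inner,
        v x * pderiv i (fun x => K.cutoff Finset.univ N x * eval x (K.edge i * G)) x) atTop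
      (𝓝 (∫ x in K.inner, v x * eval x (MvPolynomial.pderiv i (K.edge i * G)))) := by
    refine tendsto_integral_mul_of_bounded (M := M₁) hv ?_ ?_ ?_
    · exact .of_forall fun N => (contDiff_pderiv i (hsmooth N)).continuous.aestronglyMeasurable
    · filter_upwards [eventually_ge_atTop 0] with N hN
      exact ae_restrict_of_forall_mem K.measurableSet_inner (hM₁ N hN)
    · exact ae_restrict_of_forall_mem K.measurableSet_inner
        fun x hx => K.tendsto_pderiv_cutoff_mul i G hx
  have hrhs : Tendsto (fun N => ∫ x in K.inner,
        w x * (K.cutoff Finset.univ N x * eval x (K.edge i * G))) atTop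
      (𝓝 (∫ x in K.inner, w x * eval x (K.edge i * G))) := by
    refine tendsto_integral_mul_of_bounded (M := 1 * M₂) hw ?_ ?_ ?_
    · exact .of_forall fun N => (hsmooth N).continuous.aestronglyMeasurable
    · refine .of_forall fun N => ae_restrict_of_forall_mem K.measurableSet_inner fun x hx => ?_
      rw [abs_mul]
      exact mul_le_mul (K.abs_cutoff_le_one _ _ _) (hM₂ x hx) (abs_nonneg _) zero_le_one
    · refine ae_restrict_of_forall_mem K.measurableSet_inner fun x hx =>
        tendsto_const_nhds.congr' ?_
      filter_upwards [K.eventually_cutoff_eq_one hx] with N hN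
      rw [hN, one_mul]
  refine tendsto_nhds_unique (hlhs.congr' ?_) hrhs.neg
  filter_upwards [eventually_gt_atTop 0] with N hN
  refine h _ ?_
  simpa only [mul_comm (K.cutoff Finset.univ N _)] using
    (K.isTestFun_cutoff hN).contDiff_mul (contDiff_eval (K.edge i * G))

end Cutoff

/-! ### Orthogonal families of subspaces -/

section OrthogonalFamily

variable {X ι : Type*} [NormedAddCommGroup X] [InnerProductSpace ℝ X]

theorem orthogonalFamily_span_image {κ : Type*} {e : κ → X}
    (he : Pairwise fun m n => ⟪e m, e n⟫_ℝ = 0) (c : κ → ι) :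
    OrthogonalFamily ℝ (fun i => Submodule.span ℝ (e '' {n | c n = i}))
      fun i => (Submodule.span ℝ (e '' {n | c n = i})).subtypeₗᵢ := by
  refine OrthogonalFamily.of_pairwise fun i j hij => Submodule.isOrtho_span.2 ?_
  rintro _ ⟨m, rfl, rfl⟩ _ ⟨n, rfl, rfl⟩
  exact he fun h => hij (congrArg c h)

theorem iSup_span_image {κ : Type*} (e : κ → X) (c : κ → ι) :
    ⨆ i, Submodule.span ℝ (e '' {n | c n = i}) = Submodule.span ℝ (range e) := by
  rw [← Submodule.span_iUnion, ← image_iUnion, iUnion_eq_univ_iff.2 fun n => ⟨c n, rfl⟩, image_univ]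

variable [Fintype ι]

theorem norm_le_sum_of_orthogonalFamily {S : ι → Submodule ℝ X}
    (hS : OrthogonalFamily ℝ (fun i => S i) fun i => (S i).subtypeₗᵢ)
    (hdense : (⨆ i, S i).topologicalClosure = ⊤) {v : X} {M : ι → ℝ} (hM : ∀ i, 0 ≤ M i)
    (hv : ∀ i, ∀ s ∈ S i, |⟪v, s⟫_ℝ| ≤ M i * ‖s‖) : ‖v‖ ≤ ∑ i, M i := by
  have hbound : ∀ s ∈ ⨆ i, S i, |⟪v, s⟫_ℝ| ≤ (∑ i, M i) * ‖s‖ := by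
    intro s hs
    obtain ⟨t, ht, rfl⟩ := (Submodule.mem_iSup_iff_exists_finsupp S s).1 hs
    rw [Finsupp.sum_fintype _ _ fun _ => rfl]
    have hpythagoras : ‖∑ i, t i‖ ^ 2 = ∑ i, ‖t i‖ ^ 2 :=
      hS.norm_sum (fun i => ⟨t i, ht i⟩) Finset.univ
    have hle : ∀ i, ‖t i‖ ≤ ‖∑ i, t i‖ := fun i => by
      refine le_of_sq_le_sq ?_ (norm_nonneg _)
      rw [hpythagoras]
      exact Finset.single_le_sum (fun j _ => sq_nonneg ‖t j‖) (Finset.mem_univ i)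
    rw [inner_sum, Finset.sum_mul]
    exact (Finset.abs_sum_le_sum_abs _ _).trans (Finset.sum_le_sum fun i _ =>
      (hv i _ (ht i)).trans (mul_le_mul_of_nonneg_left (hle i) (hM i)))
  have hself : |⟪v, v⟫_ℝ| ≤ (∑ i, M i) * ‖v‖ := by
    refine closure_minimal (t := {s | |⟪v, s⟫_ℝ| ≤ (∑ i, M i) * ‖s‖}) hbound
      (isClosed_le (by fun_prop) (by fun_prop)) ?_
    rw [← Submodule.topologicalClosure_coe, hdense]
    trivial
  rw [real_inner_self_eq_norm_sq, abs_of_nonneg (sq_nonneg _), sq] at hself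
  rcases (norm_nonneg v).eq_or_lt with h | h
  · rw [← h]
    exact Finset.sum_nonneg fun i _ => hM i
  · exact le_of_mul_le_mul_right hself h

theorem exists_mem_norm_sub_le_of_orthogonalFamily {S : Option ι → Submodule ℝ X}
    (hS : OrthogonalFamily ℝ (fun o => S o) fun o => (S o).subtypeₗᵢ)
    (hdense : (⨆ o, S o).topologicalClosure = ⊤) [(S none).HasOrthogonalProjection] {v : X}
    {M : ι → ℝ} (hM : ∀ i, 0 ≤ M i) (hv : ∀ i, ∀ s ∈ S (some i), |⟪v, s⟫_ℝ| ≤ M i * ‖s‖) :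
    ∃ q ∈ S none, ‖v - q‖ ≤ ∑ i, M i := by
  have hq := (S none).starProjection_apply_mem v
  refine ⟨(S none).starProjection v, hq, ?_⟩
  rw [← zero_add (∑ i, M i)]
  refine (norm_le_sum_of_orthogonalFamily hS hdense (M := fun o => o.elim 0 M)
    (Option.forall.2 ⟨le_rfl, hM⟩) (Option.forall.2 ⟨fun s hs => ?_, fun i s hs => ?_⟩)).trans_eq
    (Fintype.sum_option _)
  · rw [(S none).starProjection_inner_eq_zero v s hs]
    simp
  · have hortho : ⟪(S none).starProjection v, s⟫_ℝ = 0 :=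
      hS (by simp : none ≠ some i) ⟨_, hq⟩ ⟨s, hs⟩
    rw [inner_sub_left, hortho, sub_zero]
    exact hv i s hs

end OrthogonalFamily

/-! ### Legendre polynomials and their tensor products -/

section Legendre

open scoped Pointwise

open Polynomial

/-- The Legendre polynomial of degree `n` on the interval `[a, b]`, defined by Rodrigues' formula
and without normalization. -/
def legendre (a b : ℝ) (n : ℕ) : ℝ[X] := derivative^[n] (((X - C a) * (C b - X)) ^ n)

theorem degree_legendre (a b : ℝ) (n : ℕ) : (legendre a b n).degree = n := by
  have hdeg : ((X - C a) * (C b - X) : ℝ[X]).natDegree = 2 := by compute_degree!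
  have hpow : (((X - C a) * (C b - X) : ℝ[X]) ^ n).natDegree = 2 * n := by
    rw [natDegree_pow, hdeg, mul_comm]
  have hne : ((X - C a) * (C b - X) : ℝ[X]) ≠ 0 := fun h => by simp [h] at hdeg
  refine le_antisymm (degree_le_of_natDegree_le ?_) (le_degree_of_ne_zero ?_)
  · refine (natDegree_iterate_derivative _ _).trans ?_
    omega
  · rw [legendre, coeff_iterate_derivative, ← two_mul, ← hpow, coeff_natDegree, hpow]
    refine smul_ne_zero ?_ (leadingCoeff_ne_zero.2 (pow_ne_zero n hne))
    rw [Ne, Nat.descFactorial_eq_zero_iff_lt]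
    omega

theorem natDegree_legendre (a b : ℝ) (n : ℕ) : (legendre a b n).natDegree = n :=
  natDegree_eq_of_degree_eq_some (degree_legendre a b n)

theorem exists_iterate_derivative_eq_legendre (a b : ℝ) {k n : ℕ} (hk : k ≤ n) :
    ∃ P, derivative^[k] P = legendre a b n ∧ ((X - C a) * (C b - X)) ^ k ∣ P := by
  refine ⟨derivative^[n - k] (((X - C a) * (C b - X)) ^ n), ?_, ?_⟩
  · rw [← Function.iterate_add_apply, Nat.add_sub_cancel' hk, legendre]
  · simpa only [Nat.sub_sub_self hk] using pow_sub_dvd_iterate_derivative_pow _ n (n - k)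

theorem pderiv_toMvPolynomial_self (i : Fin d) (P : ℝ[X]) :
    MvPolynomial.pderiv i (P.toMvPolynomial i) = (derivative P).toMvPolynomial i := by
  rw [toMvPolynomial, Derivation.map_aeval, MvPolynomial.pderiv_X_self, smul_eq_mul, mul_one]

theorem pderiv_toMvPolynomial_of_ne {j : Fin d} (h : j ≠ i) (P : ℝ[X]) :
    MvPolynomial.pderiv i (P.toMvPolynomial j) = 0 := by
  rw [toMvPolynomial, Derivation.map_aeval, MvPolynomial.pderiv_X_of_ne h, smul_zero]

theorem degreeOf_toMvPolynomial_self_le (i : Fin d) (P : ℝ[X]) :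
    (P.toMvPolynomial i).degreeOf i ≤ P.natDegree := by
  rw [toMvPolynomial, aeval_eq_sum_range]
  refine (MvPolynomial.degreeOf_sum_le _ _ _).trans (Finset.sup_le fun m hm => ?_)
  rw [MvPolynomial.smul_eq_C_mul]
  refine (MvPolynomial.degreeOf_C_mul_le _ _ _).trans ?_
  rw [MvPolynomial.degreeOf_X_self_pow]
  exact Finset.mem_range_succ_iff.1 hm

theorem degreeOf_toMvPolynomial_of_ne {j : Fin d} (h : i ≠ j) (P : ℝ[X]) :
    (P.toMvPolynomial j).degreeOf i = 0 := by
  rw [toMvPolynomial, aeval_eq_sum_range]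
  refine Nat.le_zero.1 ((MvPolynomial.degreeOf_sum_le _ _ _).trans (Finset.sup_le fun m _ => ?_))
  rw [MvPolynomial.smul_eq_C_mul]
  exact (MvPolynomial.degreeOf_C_mul_le _ _ _).trans_eq (MvPolynomial.degreeOf_X_pow_of_ne _ h)

theorem iterate_pderiv_toMvPolynomial_mul (i : Fin d) (k : ℕ) (P : ℝ[X])
    {R : MvPolynomial (Fin d) ℝ} (hR : MvPolynomial.pderiv i R = 0) :
    (MvPolynomial.pderiv i)^[k] (P.toMvPolynomial i * R) =
      (derivative^[k] P).toMvPolynomial i * R := by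
  induction k generalizing P with
  | zero => rfl
  | succ k ih =>
    rw [Function.iterate_succ_apply, MvPolynomial.pderiv_mul, hR, mul_zero, add_zero,
      pderiv_toMvPolynomial_self, ih, Function.iterate_succ_apply]

theorem span_range_prod_toMvPolynomial {P : Fin d → ℕ → ℝ[X]}
    (hP : ∀ i n, (P i n).degree = n) :
    Submodule.span ℝ (range fun n : Fin d → ℕ => ∏ i, (P i (n i)).toMvPolynomial i) =
      ∏ i, LinearMap.range (toMvPolynomial (R := ℝ) i).toLinearMap := by
  have hrange : (range fun n : Fin d → ℕ => ∏ i, (P i (n i)).toMvPolynomial i) =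
      ∏ i, range fun n => (P i n).toMvPolynomial i := by
    ext q
    simp only [mem_fintype_prod, mem_range]
    constructor
    · rintro ⟨n, rfl⟩
      exact ⟨_, fun i => ⟨n i, rfl⟩, rfl⟩
    · rintro ⟨g, hg, rfl⟩
      choose n hn using hg
      exact ⟨n, Finset.prod_congr rfl fun i _ => hn i⟩
  rw [hrange, ← Submodule.prod_span]
  refine Finset.prod_congr rfl fun i _ => ?_
  let P_seq : Polynomial.Sequence ℝ := ⟨P i, hP i⟩
  have htop : Submodule.span ℝ (range (P i)) = ⊤ :=
    P_seq.span fun n => (leadingCoeff_ne_zero.2 (P_seq.ne_zero n)).isUnit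
  rw [LinearMap.range_eq_map, ← htop, Submodule.map_span, ← range_comp]
  rfl

/-- The tensor product of the Legendre polynomials of the degrees `n i` on the edges of a
rectangle. These form an orthogonal basis of `L²(K)`. -/
def Rect.tensor (K : Rect d) (n : Fin d → ℕ) : MvPolynomial (Fin d) ℝ :=
  ∏ i, (legendre (K.lo i) (K.hi i) (n i)).toMvPolynomial i

theorem Rect.exists_tensor_eq_mul (K : Rect d) (n : Fin d → ℕ) (i : Fin d) :
    ∃ R, MvPolynomial.pderiv i R = 0 ∧
      K.tensor n = (legendre (K.lo i) (K.hi i) (n i)).toMvPolynomial i * R := by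
  refine ⟨∏ j ∈ Finset.univ.erase i, (legendre (K.lo j) (K.hi j) (n j)).toMvPolynomial j, ?_,
    (Finset.mul_prod_erase _ _ (Finset.mem_univ i)).symm⟩
  refine Finset.prod_induction _ (MvPolynomial.pderiv i · = 0) (fun q r hq hr => ?_)
    MvPolynomial.pderiv_one fun j hj => pderiv_toMvPolynomial_of_ne (Finset.ne_of_mem_erase hj) _
  rw [MvPolynomial.pderiv_mul, hq, hr, zero_mul, mul_zero, add_zero]

theorem Rect.exists_iterate_pderiv_eq_tensor (K : Rect d) {n : Fin d → ℕ} {k : ℕ}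
    (hk : k ≤ n i) :
    ∃ G, (MvPolynomial.pderiv i)^[k] G = K.tensor n ∧ K.edge i ^ k ∣ G := by
  obtain ⟨R, hR, htensor⟩ := K.exists_tensor_eq_mul n i
  obtain ⟨P, hP, hdvd⟩ := exists_iterate_derivative_eq_legendre (K.lo i) (K.hi i) hk
  have hedge : toMvPolynomial i ((X - C (K.lo i)) * (C (K.hi i) - X)) = K.edge i := by
    simp [Rect.edge]
  refine ⟨P.toMvPolynomial i * R, ?_, Dvd.dvd.mul_right ?_ R⟩
  · rw [iterate_pderiv_toMvPolynomial_mul i k P hR, hP, htensor]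
  · rw [← hedge, ← map_pow]
    exact map_dvd _ hdvd

theorem Rect.iterate_pderiv_tensor_eq_zero (K : Rect d) {n : Fin d → ℕ} {k : ℕ} (hk : n i < k) :
    (MvPolynomial.pderiv i)^[k] (K.tensor n) = 0 := by
  obtain ⟨R, hR, htensor⟩ := K.exists_tensor_eq_mul n i
  rw [htensor, iterate_pderiv_toMvPolynomial_mul i k _ hR,
    iterate_derivative_eq_zero (by rwa [natDegree_legendre]), map_zero, zero_mul]

theorem Rect.degreeOf_tensor_le (K : Rect d) (n : Fin d → ℕ) (i : Fin d) :
    (K.tensor n).degreeOf i ≤ n i := by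
  refine (MvPolynomial.degreeOf_prod_le _ _ _).trans ?_
  rw [Finset.sum_eq_single_of_mem i (Finset.mem_univ i)
    fun j _ hj => degreeOf_toMvPolynomial_of_ne hj.symm _]
  exact (degreeOf_toMvPolynomial_self_le i _).trans_eq (natDegree_legendre _ _ _)

theorem Rect.span_range_tensor (K : Rect d) : Submodule.span ℝ (range K.tensor) = ⊤ := by
  have hmonomial : (range fun n : Fin d → ℕ => ∏ i, (X ^ n i : ℝ[X]).toMvPolynomial i) =
      range fun m : Fin d →₀ ℕ => MvPolynomial.monomial m (1 : ℝ) := by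
    rw [← Finsupp.equivFunOnFinite.surjective.range_comp]
    congr 1
    funext m
    simp [MvPolynomial.monomial_eq, Finsupp.prod_fintype]
  have hbasis := (MvPolynomial.basisMonomials (Fin d) ℝ).span_eq
  rw [MvPolynomial.coe_basisMonomials, ← hmonomial,
    span_range_prod_toMvPolynomial fun _ n => degree_X_pow n] at hbasis
  exact (span_range_prod_toMvPolynomial fun i n => degree_legendre (K.lo i) (K.hi i) n).trans hbasis

end Legendre

/-! ### Square integrable functions -/

section SquareIntegrable

variable {X : Type*} [MeasurableSpace X] {μ : Measure X} {f g : X → ℝ}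

theorem inner_toLp_toLp (hf : MemLp f 2 μ) (hg : MemLp g 2 μ) :
    inner ℝ (hf.toLp f) (hg.toLp g) = ∫ x, f x * g x ∂μ := by
  rw [L2.inner_def]
  refine integral_congr_ae ?_
  filter_upwards [hf.coeFn_toLp, hg.coeFn_toLp] with x hfx hgx
  rw [hfx, hgx, RCLike.inner_apply, conj_trivial, mul_comm]

theorem norm_toLp_sq (hf : MemLp f 2 μ) : ‖hf.toLp f‖ ^ 2 = ∫ x, f x ^ 2 ∂μ := by
  rw [← real_inner_self_eq_norm_sq, inner_toLp_toLp]
  simp only [sq]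

theorem inner_eq_integral (f g : Lp ℝ 2 μ) : inner ℝ f g = ∫ x, f x * g x ∂μ := by
  rw [← inner_toLp_toLp (Lp.memLp f) (Lp.memLp g), Lp.toLp_coeFn, Lp.toLp_coeFn]

theorem norm_sq_eq_integral (f : Lp ℝ 2 μ) : ‖f‖ ^ 2 = ∫ x, f x ^ 2 ∂μ := by
  rw [← norm_toLp_sq (Lp.memLp f), Lp.toLp_coeFn]

/-- The Poincaré and Friedrichs inequalities result from integration by parts against the
coordinate `y`, which gives the identity `h`. -/
theorem integral_sq_le_of_integral_sq_eq {y : X → ℝ} {R : ℝ} (hf : MemLp f 2 μ)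
    (hg : MemLp g 2 μ) (hy : ∀ᵐ x ∂μ, |y x| ≤ R)
    (h : ∫ x, f x ^ 2 ∂μ = ∫ x, -2 * (y x * (f x * g x)) ∂μ) :
    ∫ x, f x ^ 2 ∂μ ≤ (2 * R) ^ 2 * ∫ x, g x ^ 2 ∂μ := by
  have hyoung : |∫ x, f x ^ 2 ∂μ| ≤ ∫ x, (1 / 2 * f x ^ 2 + 2 * R ^ 2 * g x ^ 2) ∂μ := by
    rw [h, ← Real.norm_eq_abs]
    refine norm_integral_le_of_norm_le
      ((hf.integrable_sq.const_mul _).add (hg.integrable_sq.const_mul _)) ?_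
    filter_upwards [hy] with x hx
    have hyfg : |y x| * (|f x| * |g x|) ≤ R * (|f x| * |g x|) := by gcongr
    calc ‖-2 * (y x * (f x * g x))‖ = 2 * (|y x| * (|f x| * |g x|)) := by
          simp only [Real.norm_eq_abs, abs_mul, abs_neg, abs_two]
      _ ≤ 1 / 2 * |f x| ^ 2 + 2 * R ^ 2 * |g x| ^ 2 := by
          linarith [sq_nonneg (|f x| - 2 * R * |g x|)]
      _ = 1 / 2 * f x ^ 2 + 2 * R ^ 2 * g x ^ 2 := by simp only [sq_abs]
  rw [integral_add (hf.integrable_sq.const_mul _) (hg.integrable_sq.const_mul _),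
    integral_const_mul, integral_const_mul] at hyoung
  linarith [le_abs_self (∫ x, f x ^ 2 ∂μ)]

end SquareIntegrable

/-! ### Polynomials in `L²(K)` -/

theorem Rect.memLp_eval (K : Rect d) (q : MvPolynomial (Fin d) ℝ) :
    MemLp (fun x => eval x q) 2 (volume.restrict K.inner) :=
  K.memLp_of_continuous (MvPolynomial.continuous_eval q)

/-- Polynomials as elements of `L²(K)`. -/
def Rect.polyL2 (K : Rect d) : MvPolynomial (Fin d) ℝ →ₗ[ℝ] L2 K.inner where
  toFun q := (K.memLp_eval q).toLp _
  map_add' q r := by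
    rw [← MemLp.toLp_add]
    exact MemLp.toLp_congr _ _ (.of_forall fun x => by simp)
  map_smul' c q := by
    rw [RingHom.id_apply, ← MemLp.toLp_const_smul]
    exact MemLp.toLp_congr _ _ (.of_forall fun x => by simp)

theorem Rect.polyL2_apply (K : Rect d) (q : MvPolynomial (Fin d) ℝ) :
    K.polyL2 q = (K.memLp_eval q).toLp _ := rfl

theorem Rect.exists_eval_near (K : Rect d) {g : (Fin d → ℝ) → ℝ} (hg : Continuous g) {ε : ℝ}
    (hε : 0 < ε) : ∃ q : MvPolynomial (Fin d) ℝ, ∀ x ∈ K.inner, |eval x q - g x| < ε := by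
  let φ : MvPolynomial (Fin d) ℝ →ₐ[ℝ] C(Fin d → ℝ, ℝ) :=
    MvPolynomial.aeval fun i => ⟨fun x => x i, continuous_apply i⟩
  have hφ : ∀ q x, φ q x = eval x q := fun q x => by
    induction q using MvPolynomial.induction_on with
    | C a => simp [φ]
    | add q r hq hr => rw [map_add, ContinuousMap.add_apply, hq, hr, map_add]
    | mul_X q j hq => rw [map_mul, ContinuousMap.mul_apply, hq, map_mul]; simp [φ]
  have hsep : φ.range.SeparatesPoints := fun x y hxy => by
    obtain ⟨i, hi⟩ := Function.ne_iff.1 hxy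
    exact ⟨_, ⟨φ (MvPolynomial.X i), ⟨_, rfl⟩, rfl⟩, by simpa only [hφ, MvPolynomial.eval_X]⟩
  obtain ⟨_, ⟨q, rfl⟩, hq⟩ :=
    ContinuousMap.exists_mem_subalgebra_near_continuous_of_isCompact_of_separatesPoints hsep
      ⟨g, hg⟩ K.isCompact_closed hε
  refine ⟨q, fun x hx => ?_⟩
  rw [← hφ]
  exact hq x (K.inner_subset_closed hx)

theorem Rect.denseRange_polyL2 (K : Rect d) : DenseRange K.polyL2 := by
  intro f
  rw [Metric.mem_closure_range_iff]
  intro ε hε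
  let μ := volume.restrict K.inner
  let c : ℝ := (measureUnivNNReal μ : ℝ) ^ ((2 : ENNReal).toReal)⁻¹
  have : 0 ≤ c := by positivity
  obtain ⟨g, hg⟩ := (BoundedContinuousFunction.toLp_denseRange (μ := μ) (p := 2)
    (E := ℝ) (𝕜 := ℝ) (by norm_num)).exists_dist_lt f (half_pos hε)
  obtain ⟨q, hq⟩ := K.exists_eval_near g.continuous (show 0 < ε / 2 / (c + 1) by positivity)
  have hgq : dist (BoundedContinuousFunction.toLp 2 μ ℝ g) (K.polyL2 q) ≤
      c * (ε / 2 / (c + 1)) := by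
    rw [dist_eq_norm, K.polyL2_apply]
    refine Lp.norm_le_of_ae_bound (by positivity) ?_
    filter_upwards [Lp.coeFn_sub (BoundedContinuousFunction.toLp 2 μ ℝ g) (K.memLp_eval q).toLp,
      BoundedContinuousFunction.coeFn_toLp 2 μ ℝ g, (K.memLp_eval q).coeFn_toLp,
      ae_restrict_mem K.measurableSet_inner] with x hsub hgx hqx hx
    rw [hsub, Pi.sub_apply, hgx, hqx, Real.norm_eq_abs, abs_sub_comm]
    exact (hq x hx).le
  have hlt : c * (ε / 2 / (c + 1)) ≤ ε / 2 := by
    rw [mul_div_assoc', div_le_iff₀ (by positivity)]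
    nlinarith
  exact ⟨q, (dist_triangle _ (BoundedContinuousFunction.toLp 2 μ ℝ g) _).trans_lt (by linarith)⟩

/-! ### Iterated integration by parts and the Poincaré inequality on a rectangle -/

/-- `h` is the `k`-th weak derivative `∂_i^k g` on `U`, and the derivatives of `g` in direction `i`
up to that order are square integrable. -/
inductive IsIterWeakPDeriv (U : Set (Fin d → ℝ)) (i : Fin d) (g : (Fin d → ℝ) → ℝ) :
    ℕ → ((Fin d → ℝ) → ℝ) → Prop
  | zero (hg : MemLp g 2 (volume.restrict U)) : IsIterWeakPDeriv U i g 0 g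
  | succ {k : ℕ} {h h' : (Fin d → ℝ) → ℝ} (hk : IsIterWeakPDeriv U i g k h)
      (hh' : IsWeakPDeriv U i h h') (hmem : MemLp h' 2 (volume.restrict U)) :
      IsIterWeakPDeriv U i g (k + 1) h'

theorem IsIterWeakPDeriv.memLp {U : Set (Fin d → ℝ)} {k : ℕ} {g h : (Fin d → ℝ) → ℝ}
    (hk : IsIterWeakPDeriv U i g k h) : MemLp h 2 (volume.restrict U) := by
  cases hk <;> assumption

theorem Rect.isIterWeakPDeriv_eval (K : Rect d) (i : Fin d) (k : ℕ) (q : MvPolynomial (Fin d) ℝ) :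
    IsIterWeakPDeriv K.inner i (fun x => eval x q) k
      fun x => eval x ((MvPolynomial.pderiv i)^[k] q) := by
  induction k with
  | zero => exact .zero (K.memLp_eval q)
  | succ k ih =>
    refine ih.succ ?_ (K.memLp_eval _)
    rw [Function.iterate_succ_apply', ← pderiv_eval]
    exact isWeakPDeriv_of_contDiff i (contDiff_eval _)

theorem edge_pow_dvd_pderiv {K : Rect d} {k : ℕ} {G : MvPolynomial (Fin d) ℝ}
    (hG : K.edge i ^ (k + 1) ∣ G) : K.edge i ^ k ∣ MvPolynomial.pderiv i G := by
  obtain ⟨G, rfl⟩ := hG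
  rw [MvPolynomial.pderiv_mul, MvPolynomial.pderiv_pow, pow_succ, Nat.add_sub_cancel]
  exact dvd_add (((dvd_mul_left _ _).mul_right _).mul_right _) ((dvd_mul_right _ _).mul_right _)

theorem IsIterWeakPDeriv.integral_mul_iterate_pderiv {K : Rect d} {k : ℕ}
    {g h : (Fin d → ℝ) → ℝ} (hk : IsIterWeakPDeriv K.inner i g k h)
    {G : MvPolynomial (Fin d) ℝ} (hG : K.edge i ^ k ∣ G) :
    ∫ x in K.inner, g x * eval x ((MvPolynomial.pderiv i)^[k] G) =
      (-1) ^ k * ∫ x in K.inner, h x * eval x G := by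
  induction hk generalizing G with
  | zero => simp
  | succ hk hh' hmem ih =>
    rw [Function.iterate_succ_apply, ih (edge_pow_dvd_pderiv hG),
      hh'.integral_mul_pderiv (hk.memLp.integrable (by norm_num)) (hmem.integrable (by norm_num))
        ((dvd_pow_self _ (Nat.succ_ne_zero _)).trans hG), pow_succ]
    ring

theorem Rect.integral_eval_pderiv_eq_zero (K : Rect d) {G : MvPolynomial (Fin d) ℝ}
    (hG : K.edge i ∣ G) : ∫ x in K.inner, eval x (MvPolynomial.pderiv i G) = 0 := by
  have hone : IsWeakPDeriv K.inner i (fun _ => (1 : ℝ)) fun _ => 0 := by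
    have hzero : pderiv i (fun _ => (1 : ℝ)) = fun _ => 0 := by
      funext x
      simp [pderiv]
    exact hzero ▸ isWeakPDeriv_of_contDiff i contDiff_const
  simpa using hone.integral_mul_pderiv (integrable_const _) (integrable_const _) hG

theorem Rect.norm_polyL2_le (K : Rect d) {G : MvPolynomial (Fin d) ℝ} (hG : K.edge i ∣ G) :
    ‖K.polyL2 G‖ ≤ 2 * (K.hi i - K.lo i) * ‖K.polyL2 (MvPolynomial.pderiv i G)‖ := by
  have hlt := K.lt i
  have hzero := K.integral_eval_pderiv_eq_zero
    (Dvd.dvd.mul_left (hG.mul_right G) (MvPolynomial.X i - MvPolynomial.C (K.lo i)))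
  refine le_of_sq_le_sq ?_ (mul_nonneg (by linarith) (norm_nonneg _))
  rw [mul_pow, K.polyL2_apply, K.polyL2_apply, norm_toLp_sq, norm_toLp_sq]
  refine integral_sq_le_of_integral_sq_eq (y := fun x => x i - K.lo i) (K.memLp_eval _)
    (K.memLp_eval _) ?_ ?_
  · filter_upwards [ae_restrict_mem K.measurableSet_inner] with x hx
    obtain ⟨hlo, hhi⟩ := hx i trivial
    rw [abs_of_pos (sub_pos.2 hlo)]
    linarith
  · rw [← sub_eq_zero, ← hzero, ← integral_sub]
    · congr 1
      funext x
      simp only [MvPolynomial.pderiv_mul, map_sub, MvPolynomial.pderiv_X_self,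
        MvPolynomial.pderiv_C, map_add, map_mul, map_one, map_zero, MvPolynomial.eval_X,
        MvPolynomial.eval_C]
      ring
    · exact (K.memLp_eval G).integrable_sq
    · exact ((K.memLp_eval (-2 * ((MvPolynomial.X i - MvPolynomial.C (K.lo i)) *
        (G * MvPolynomial.pderiv i G)))).integrable (by norm_num)).congr
          (.of_forall fun x => by simp)

theorem Rect.norm_polyL2_le_iterate (K : Rect d) {k : ℕ} {G : MvPolynomial (Fin d) ℝ}
    (hG : K.edge i ^ k ∣ G) : ‖K.polyL2 G‖ ≤
      (2 * (K.hi i - K.lo i)) ^ k * ‖K.polyL2 ((MvPolynomial.pderiv i)^[k] G)‖ := by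
  have hlt := K.lt i
  induction k generalizing G with
  | zero => simp
  | succ k ih =>
    rw [pow_succ', mul_assoc, Function.iterate_succ_apply]
    exact (K.norm_polyL2_le ((dvd_pow_self _ k.succ_ne_zero).trans hG)).trans
      (mul_le_mul_of_nonneg_left (ih (edge_pow_dvd_pderiv hG)) (by linarith))

/-! ### The Bramble–Hilbert lemma -/

theorem IsIterWeakPDeriv.abs_inner_polyL2_le {K : Rect d} {k : ℕ} {f h : (Fin d → ℝ) → ℝ}
    (hk : IsIterWeakPDeriv K.inner i f k h) (hf : MemLp f 2 (volume.restrict K.inner))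
    {G : MvPolynomial (Fin d) ℝ} (hG : K.edge i ^ k ∣ G) :
    |inner ℝ (hf.toLp f) (K.polyL2 ((MvPolynomial.pderiv i)^[k] G))| ≤
      (2 * (K.hi i - K.lo i)) ^ k * ‖hk.memLp.toLp h‖ *
        ‖K.polyL2 ((MvPolynomial.pderiv i)^[k] G)‖ := by
  rw [K.polyL2_apply, inner_toLp_toLp, hk.integral_mul_iterate_pderiv hG,
    ← inner_toLp_toLp hk.memLp (K.memLp_eval G), ← K.polyL2_apply, abs_mul, abs_pow, abs_neg,
    abs_one, one_pow, one_mul, mul_right_comm, mul_comm _ ‖hk.memLp.toLp h‖]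
  exact (abs_real_inner_le_norm _ _).trans
    (mul_le_mul_of_nonneg_left (K.norm_polyL2_le_iterate hG) (norm_nonneg _))

theorem Rect.inner_tensor_eq_zero_of_lt (K : Rect d) {m n : Fin d → ℕ} (h : m i < n i) :
    ⟪K.polyL2 (K.tensor m), K.polyL2 (K.tensor n)⟫_ℝ = 0 := by
  obtain ⟨G, htensor, hG⟩ := K.exists_iterate_pderiv_eq_tensor (le_refl (n i))
  rw [K.polyL2_apply, K.polyL2_apply, inner_toLp_toLp, ← htensor,
    (K.isIterWeakPDeriv_eval i (n i) (K.tensor m)).integral_mul_iterate_pderiv hG,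
    K.iterate_pderiv_tensor_eq_zero h]
  simp

theorem Rect.pairwise_inner_tensor_eq_zero (K : Rect d) :
    Pairwise fun m n => ⟪K.polyL2 (K.tensor m), K.polyL2 (K.tensor n)⟫_ℝ = 0 := by
  intro m n hmn
  obtain ⟨i, hi⟩ := Function.ne_iff.1 hmn
  rcases hi.lt_or_gt with hlt | hgt
  · exact K.inner_tensor_eq_zero_of_lt hlt
  · rw [real_inner_comm, K.inner_tensor_eq_zero_of_lt hgt]

theorem Rect.topologicalClosure_span_tensor (K : Rect d) :
    (Submodule.span ℝ (range fun n => K.polyL2 (K.tensor n))).topologicalClosure = ⊤ := by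
  rw [range_comp' K.polyL2, Submodule.span_image, K.span_range_tensor, Submodule.map_top,
    ← Submodule.dense_iff_topologicalClosure_eq_top]
  exact K.denseRange_polyL2

theorem Rect.exists_iterate_pderiv_eq_of_mem_span (K : Rect d) {k : ℕ} {s : L2 K.inner}
    (hs : s ∈ Submodule.span ℝ ((fun n => K.polyL2 (K.tensor n)) '' {n | k ≤ n i})) :
    ∃ G, K.edge i ^ k ∣ G ∧ K.polyL2 ((MvPolynomial.pderiv i)^[k] G) = s := by
  have hle : Submodule.span ℝ ((fun n => K.polyL2 (K.tensor n)) '' {n | k ≤ n i}) ≤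
      ((Ideal.span {K.edge i ^ k}).restrictScalars ℝ).map
        (K.polyL2 ∘ₗ (MvPolynomial.pderiv i).toLinearMap ^ k) := by
    rw [Submodule.span_le]
    rintro _ ⟨n, hn, rfl⟩
    obtain ⟨G, htensor, hG⟩ := K.exists_iterate_pderiv_eq_tensor hn
    refine ⟨G, Ideal.mem_span_singleton.2 hG, ?_⟩
    rw [LinearMap.comp_apply, Module.End.pow_apply]
    exact congrArg K.polyL2 htensor
  obtain ⟨G, hG, rfl⟩ := hle hs
  refine ⟨G, Ideal.mem_span_singleton.1 hG, ?_⟩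
  rw [LinearMap.comp_apply, Module.End.pow_apply]
  rfl

theorem mem_restrictDegree_iff_degreeOf_le {p : ℕ} {q : MvPolynomial (Fin d) ℝ} :
    q ∈ MvPolynomial.restrictDegree (Fin d) ℝ p ↔ ∀ i, q.degreeOf i ≤ p := by
  simp only [MvPolynomial.mem_restrictDegree, MvPolynomial.degreeOf_le_iff]
  exact ⟨fun h i s hs => h s hs i, fun h s hs i => h i s hs⟩

theorem Rect.exists_degreeOf_le_of_mem_span (K : Rect d) {p : ℕ} {s : L2 K.inner}
    (hs : s ∈ Submodule.span ℝ ((fun n => K.polyL2 (K.tensor n)) '' {n | ∀ i, n i ≤ p})) :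
    ∃ q : MvPolynomial (Fin d) ℝ, (∀ i, q.degreeOf i ≤ p) ∧ K.polyL2 q = s := by
  have hle : Submodule.span ℝ ((fun n => K.polyL2 (K.tensor n)) '' {n | ∀ i, n i ≤ p}) ≤
      (MvPolynomial.restrictDegree (Fin d) ℝ p).map K.polyL2 := by
    rw [Submodule.span_le]
    rintro _ ⟨n, hn, rfl⟩
    exact ⟨_, mem_restrictDegree_iff_degreeOf_le.2 fun i => (K.degreeOf_tensor_le n i).trans (hn i),
      rfl⟩
  obtain ⟨q, hq, rfl⟩ := hle hs
  exact ⟨q, mem_restrictDegree_iff_degreeOf_le.1 hq, rfl⟩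

theorem Rect.exists_norm_sub_polyL2_le (K : Rect d) {p : ℕ} {f : (Fin d → ℝ) → ℝ}
    {g : Fin d → (Fin d → ℝ) → ℝ} (hf : MemLp f 2 (volume.restrict K.inner))
    (hg : ∀ i, IsIterWeakPDeriv K.inner i f (p + 1) (g i)) :
    ∃ q : MvPolynomial (Fin d) ℝ, (∀ i, q.degreeOf i ≤ p) ∧ ‖hf.toLp f - K.polyL2 q‖ ≤
      ∑ i, (2 * (K.hi i - K.lo i)) ^ (p + 1) * ‖(hg i).memLp.toLp (g i)‖ := by
  let e : (Fin d → ℕ) → L2 K.inner := fun n => K.polyL2 (K.tensor n)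
  -- The first index at which the degree is too large sorts the basis into orthogonal classes.
  let c : (Fin d → ℕ) → Option (Fin d) := fun n => Fin.find? fun i => p + 1 ≤ n i
  have hsome : ∀ i, {n | c n = some i} ⊆ {n | p + 1 ≤ n i} := fun i n hn =>
    of_decide_eq_true (Fin.eq_true_of_find?_eq_some hn)
  have hnone : {n | c n = none} ⊆ {n | ∀ i, n i ≤ p} := fun n hn i =>
    Nat.lt_succ_iff.1 (not_le.1 (of_decide_eq_false (Fin.eq_false_of_find?_eq_none hn i)))
  have : FiniteDimensional ℝ (Submodule.span ℝ (e '' {n | c n = none})) :=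
    .span_of_finite ℝ (((Set.finite_Iic fun _ : Fin d => p).subset hnone).image e)
  have hpos : ∀ i, 0 ≤ 2 * (K.hi i - K.lo i) := fun i => by linarith [K.lt i]
  obtain ⟨s, hs, hle⟩ := exists_mem_norm_sub_le_of_orthogonalFamily (v := hf.toLp f)
    (orthogonalFamily_span_image K.pairwise_inner_tensor_eq_zero c)
    (by rw [iSup_span_image, K.topologicalClosure_span_tensor])
    (fun i => mul_nonneg (pow_nonneg (hpos i) (p + 1)) (norm_nonneg ((hg i).memLp.toLp (g i))))
    fun i s hs => by
      obtain ⟨G, hG, rfl⟩ := K.exists_iterate_pderiv_eq_of_mem_span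
        (Submodule.span_mono (image_mono (hsome i)) hs)
      exact (hg i).abs_inner_polyL2_le hf hG
  obtain ⟨q, hq, rfl⟩ := K.exists_degreeOf_le_of_mem_span
    (Submodule.span_mono (image_mono hnone) hs)
  exact ⟨q, hq, hle⟩

theorem Rect.exists_integral_sub_eval_sq_le (K : Rect d) {p : ℕ} {f : (Fin d → ℝ) → ℝ}
    {g : Fin d → (Fin d → ℝ) → ℝ} (hf : MemLp f 2 (volume.restrict K.inner))
    (hg : ∀ i, IsIterWeakPDeriv K.inner i f (p + 1) (g i)) {h : ℝ}
    (hh : ∀ i, K.hi i - K.lo i ≤ h) :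
    ∃ q : MvPolynomial (Fin d) ℝ, (∀ i, q.degreeOf i ≤ p) ∧
      ∫ x in K.inner, (f x - eval x q) ^ 2 ≤
        d * ((2 * h) ^ (p + 1)) ^ 2 * ∑ i, ∫ x in K.inner, g i x ^ 2 := by
  obtain ⟨q, hq, hle⟩ := K.exists_norm_sub_polyL2_le hf hg
  have hpos : ∀ i, 0 ≤ 2 * (K.hi i - K.lo i) := fun i => by linarith [K.lt i]
  have hnorm : ‖hf.toLp f - K.polyL2 q‖ ≤
      (2 * h) ^ (p + 1) * ∑ i, ‖(hg i).memLp.toLp (g i)‖ := by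
    rw [Finset.mul_sum]
    refine hle.trans (Finset.sum_le_sum fun i _ => ?_)
    gcongr
    exacts [hpos i, hh i]
  refine ⟨q, hq, ?_⟩
  calc ∫ x in K.inner, (f x - eval x q) ^ 2 = ‖hf.toLp f - K.polyL2 q‖ ^ 2 := by
        rw [K.polyL2_apply, ← MemLp.toLp_sub, norm_toLp_sq]
        rfl
    _ ≤ ((2 * h) ^ (p + 1) * ∑ i, ‖(hg i).memLp.toLp (g i)‖) ^ 2 := by gcongr
    _ ≤ ((2 * h) ^ (p + 1)) ^ 2 * (d * ∑ i, ‖(hg i).memLp.toLp (g i)‖ ^ 2) := by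
        rw [mul_pow]
        gcongr
        simpa using sq_sum_le_card_mul_sum_sq (s := Finset.univ)
          (f := fun i => ‖(hg i).memLp.toLp (g i)‖)
    _ = d * ((2 * h) ^ (p + 1)) ^ 2 * ∑ i, ∫ x in K.inner, g i x ^ 2 := by
        simp only [norm_toLp_sq]
        ring

/-! ### Piecewise functions on a mesh -/

theorem Rect.diam_nonneg (K : Rect d) : 0 ≤ K.diam := Real.sqrt_nonneg _

theorem Rect.sub_le_diam (K : Rect d) (i : Fin d) : K.hi i - K.lo i ≤ K.diam :=
  Real.le_sqrt_of_sq_le (Finset.single_le_sum (f := fun i => (K.hi i - K.lo i) ^ 2)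
    (fun _ _ => sq_nonneg _) (Finset.mem_univ i))

namespace RectMesh

variable {Ω : Set (Fin d → ℝ)} (𝒯 : RectMesh Ω) {K : Rect d}

theorem size_nonneg : 0 ≤ 𝒯.size := Real.iSup_nonneg fun K => K.1.diam_nonneg

theorem diam_le_size (hK : K ∈ 𝒯.elems) : K.diam ≤ 𝒯.size :=
  le_ciSup (f := fun K : 𝒯.elems => K.1.diam) (finite_range _).bddAbove ⟨K, hK⟩

theorem isBounded (𝒯 : RectMesh Ω) : Bornology.IsBounded Ω :=
  ((Bornology.isBounded_biUnion_finset 𝒯.elems).2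
    fun K _ => K.isCompact_closed.isBounded).subset 𝒯.cover

theorem biUnion_inner_ae_eq : (⋃ K ∈ 𝒯.elems, K.inner : Set (Fin d → ℝ)) =ᵐ[volume] Ω := by
  have hclosed : (⋃ K ∈ 𝒯.elems, K.inner : Set (Fin d → ℝ)) =ᵐ[volume]
      (⋃ K ∈ 𝒯.elems, K.closed : Set (Fin d → ℝ)) :=
    Filter.EventuallyEq.countable_bUnion 𝒯.elems.countable_toSet fun K _ =>
      Measure.univ_pi_Ioo_ae_eq_Icc (μ := fun _ : Fin d => (volume : Measure ℝ))
  exact (iUnion₂_subset 𝒯.inner_subset).eventuallyLE.antisymm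
    (𝒯.cover.eventuallyLE.trans hclosed.symm.le)

theorem integral_eq_sum {F : (Fin d → ℝ) → ℝ} (hF : Integrable F (volume.restrict Ω)) :
    ∫ x in Ω, F x = ∑ K ∈ 𝒯.elems, ∫ x in K.inner, F x := by
  rw [← setIntegral_congr_set 𝒯.biUnion_inner_ae_eq, integral_biUnion_finset]
  · exact fun K _ => K.measurableSet_inner
  · exact fun K hK L hL hKL => 𝒯.disjoint K hK L hL hKL
  · exact fun K hK => IntegrableOn.mono_set hF (𝒯.inner_subset K hK)

theorem norm_sq_eq_sum (f : L2 Ω) : ‖f‖ ^ 2 = ∑ K ∈ 𝒯.elems, ∫ x in K.inner, f x ^ 2 := by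
  rw [norm_sq_eq_integral, 𝒯.integral_eq_sum (Lp.memLp f).integrable_sq]

theorem memLp_inner (hK : K ∈ 𝒯.elems) (f : L2 Ω) : MemLp f 2 (volume.restrict K.inner) :=
  (Lp.memLp f).mono_measure (Measure.restrict_mono (𝒯.inner_subset K hK) le_rfl)

theorem exists_ae_eq_forall_inner {g : Rect d → (Fin d → ℝ) → ℝ}
    (hg : ∀ K ∈ 𝒯.elems, MemLp (g K) 2 (volume.restrict K.inner)) :
    ∃ q : L2 Ω, ∀ K ∈ 𝒯.elems, q =ᵐ[volume.restrict K.inner] g K := by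
  have hmem : MemLp (fun x => ∑ K ∈ 𝒯.elems, K.inner.indicator (g K) x) 2 (volume.restrict Ω) := by
    refine memLp_finsetSum _ fun K hK => ?_
    rw [memLp_indicator_iff_restrict K.measurableSet_inner,
      Measure.restrict_restrict_of_subset (𝒯.inner_subset K hK)]
    exact hg K hK
  refine ⟨hmem.toLp _, fun K hK => ?_⟩
  filter_upwards [ae_restrict_subset (𝒯.inner_subset K hK) hmem.coeFn_toLp,
    ae_restrict_mem K.measurableSet_inner] with x hx hxK
  rw [hx, Finset.sum_eq_single_of_mem K hK, indicator_of_mem hxK]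
  intro L hL hLK
  exact indicator_of_notMem (disjoint_right.1 (𝒯.disjoint L hL K hK hLK) hxK) _

theorem exists_mem_polySpace_norm_sub_le {p : ℕ} {f : L2 Ω} {g : Fin d → L2 Ω}
    (hg : ∀ K ∈ 𝒯.elems, ∀ i, IsIterWeakPDeriv K.inner i f (p + 1) (g i)) :
    ∃ q ∈ polySpace 𝒯 p,
      ‖f - q‖ ≤ √d * (2 * 𝒯.size) ^ (p + 1) * √(∑ i, ‖g i‖ ^ 2) := by
  have hlocal : ∀ K ∈ 𝒯.elems, ∃ Q : MvPolynomial (Fin d) ℝ, (∀ i, Q.degreeOf i ≤ p) ∧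
      ∫ x in K.inner, (f x - eval x Q) ^ 2 ≤
        d * ((2 * 𝒯.size) ^ (p + 1)) ^ 2 * ∑ i, ∫ x in K.inner, g i x ^ 2 := fun K hK =>
    K.exists_integral_sub_eval_sq_le (𝒯.memLp_inner hK f) (hg K hK)
      fun i => (K.sub_le_diam i).trans (𝒯.diam_le_size hK)
  choose! Q hdeg hQ using hlocal
  obtain ⟨q, hq⟩ := 𝒯.exists_ae_eq_forall_inner fun K _ => K.memLp_eval (Q K)
  refine ⟨q, fun K hK => ⟨Q K, hdeg K hK, hq K hK⟩, ?_⟩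
  have hsize := 𝒯.size_nonneg
  refine le_of_sq_le_sq ?_ (by positivity)
  rw [mul_pow, mul_pow, Real.sq_sqrt (by positivity), Real.sq_sqrt (by positivity)]
  simp only [𝒯.norm_sq_eq_sum]
  rw [Finset.sum_comm, Finset.mul_sum]
  refine Finset.sum_le_sum fun K hK => (integral_congr_ae ?_).trans_le (hQ K hK)
  filter_upwards [hq K hK, ae_restrict_subset (𝒯.inner_subset K hK) (Lp.coeFn_sub f q)]
    with x hx hsub
  rw [hsub, Pi.sub_apply, hx]

end RectMesh

/-! ### Functions in `H¹₀(Ω)` -/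

theorem IsTestFun.memLp {U : Set (Fin d → ℝ)} {φ : (Fin d → ℝ) → ℝ} (hφ : IsTestFun U φ) :
    MemLp φ 2 volume :=
  hφ.smooth.continuous.memLp_of_hasCompactSupport hφ.compact

theorem integral_sq_eq_of_isTestFun {U : Set (Fin d → ℝ)} {φ : (Fin d → ℝ) → ℝ}
    (hφ : IsTestFun U φ) (i : Fin d) :
    ∫ x in U, φ x ^ 2 = ∫ x in U, -2 * (x i * (φ x * pderiv i φ x)) := by
  have hcoord : ContDiff ℝ ∞ fun x : Fin d → ℝ => x i := contDiff_apply ℝ ℝ i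
  have hpderiv : pderiv i (fun x => x i * φ x) = fun x => x i * pderiv i φ x + φ x := by
    funext x
    rw [pderiv_mul (differentiableAt_apply i x) (hφ.smooth.differentiable (by simp) x)]
    simp [pderiv, (hasFDerivAt_apply i x).fderiv]
  have hparts := isWeakPDeriv_of_contDiff i (hφ.contDiff_mul hcoord).smooth φ hφ
  have hsq : Integrable (fun x => φ x ^ 2) (volume.restrict U) := hφ.memLp.integrable_sq.restrict
  have hmul : Integrable (fun x => x i * (φ x * pderiv i φ x)) (volume.restrict U) :=
    (((hφ.pderiv i).contDiff_mul hφ.smooth).contDiff_mul hcoord).integrable.restrict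
  have hsplit : ∫ x in U, (x i * pderiv i φ x + φ x) * φ x =
      (∫ x in U, x i * (φ x * pderiv i φ x)) + ∫ x in U, φ x ^ 2 := by
    rw [← integral_add hmul hsq]
    congr 1 with x
    ring
  simp only [hpderiv, hsplit, mul_assoc] at hparts
  rw [integral_const_mul]
  linarith

variable {Ω U : Set (Fin d → ℝ)}

theorem IsTestFun.setIntegral_mul_eq_inner {φ : (Fin d → ℝ) → ℝ} (hφ : IsTestFun U φ)
    (hUΩ : U ⊆ Ω) (g : L2 Ω) :
    ∫ x in U, g x * φ x = ⟪g, (hφ.memLp.restrict Ω).toLp φ⟫_ℝ := by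
  rw [← Measure.restrict_restrict_of_subset hUΩ,
    setIntegral_eq_integral_of_forall_compl_eq_zero fun x hx => by rw [hφ.eq_zero hx, mul_zero],
    ← inner_toLp_toLp (Lp.memLp g), Lp.toLp_coeFn]

instance : CompleteSpace (H10 Ω) :=
  inferInstanceAs (CompleteSpace (testPairs Ω Ω).topologicalClosure)

namespace H10

theorem induction_on {P : GradPair Ω → Prop} (hP : IsClosed {w | P w})
    (htest : ∀ w ∈ testPairs Ω Ω, P w) (w : H10 Ω) : P w :=
  closure_minimal htest hP w.2

theorem isWeakPDeriv (hUΩ : U ⊆ Ω) (i : Fin d) (w : H10 Ω) :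
    IsWeakPDeriv U i (toL2 w) (grad i w) := by
  intro φ hφ
  refine induction_on (P := fun w => (∫ x in U, w none x * pderiv i φ x) =
    -∫ x in U, w (some i) x * φ x) ?_ ?_ w
  · simp only [(hφ.pderiv i).setIntegral_mul_eq_inner hUΩ, hφ.setIntegral_mul_eq_inner hUΩ]
    exact isClosed_eq (by fun_prop) (by fun_prop)
  · rintro w ⟨η, hη, hw, hgrad⟩
    have hparts := isWeakPDeriv_of_contDiff i hη.smooth φ hφ
    rw [integral_congr_ae (g := fun x => η x * pderiv i φ x), hparts,
      integral_congr_ae (f := fun x => w (some i) x * φ x) (g := fun x => pderiv i η x * φ x)]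
    · filter_upwards [ae_restrict_subset hUΩ (hgrad i)] with x hx using by rw [hx]
    · filter_upwards [ae_restrict_subset hUΩ hw] with x hx using by rw [hx]

theorem norm_toL2_le {R : ℝ} (hR : 0 ≤ R) (hΩ : ∀ᵐ x ∂volume.restrict Ω, |x i| ≤ R) (w : H10 Ω) :
    ‖toL2 w‖ ≤ 2 * R * ‖grad i w‖ := by
  refine induction_on (P := fun w => ‖w none‖ ≤ 2 * R * ‖w (some i)‖) ?_ ?_ w
  · exact isClosed_le (by fun_prop) (by fun_prop)
  · rintro w ⟨η, hη, hw, hgrad⟩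
    have hnorm : ‖w none‖ ^ 2 = ∫ x in Ω, η x ^ 2 := by
      rw [norm_sq_eq_integral]
      exact integral_congr_ae (by filter_upwards [hw] with x hx using by rw [hx])
    have hnorm_grad : ‖w (some i)‖ ^ 2 = ∫ x in Ω, pderiv i η x ^ 2 := by
      rw [norm_sq_eq_integral]
      exact integral_congr_ae (by filter_upwards [hgrad i] with x hx using by rw [hx])
    refine le_of_sq_le_sq ?_ (by positivity)
    rw [mul_pow, hnorm, hnorm_grad]
    exact integral_sq_le_of_integral_sq_eq (hη.memLp.restrict Ω) ((hη.pderiv i).memLp.restrict Ω)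
      hΩ (integral_sq_eq_of_isTestFun hη i)

theorem gradNorm_sq (u : H10 Ω) : gradNorm u ^ 2 = ∑ i, ‖grad i u‖ ^ 2 :=
  Real.sq_sqrt (Finset.sum_nonneg fun _ _ => sq_nonneg _)

theorem norm_grad_le_gradNorm (i : Fin d) (u : H10 Ω) : ‖grad i u‖ ≤ gradNorm u :=
  Real.le_sqrt_of_sq_le (Finset.single_le_sum (f := fun i => ‖grad i u‖ ^ 2)
    (fun _ _ => sq_nonneg _) (Finset.mem_univ i))

theorem norm_sq_eq (u : H10 Ω) : ‖u‖ ^ 2 = ‖toL2 u‖ ^ 2 + gradNorm u ^ 2 := by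
  rw [gradNorm_sq, Submodule.coe_norm, PiLp.norm_sq_eq_of_L2, Fintype.sum_option]
  rfl

theorem exists_mul_norm_sq_le_gradNorm_sq (hd : 0 < d) (hΩ : Bornology.IsBounded Ω) :
    ∃ c : ℝ, 0 < c ∧ ∀ u : H10 Ω, c * ‖u‖ ^ 2 ≤ gradNorm u ^ 2 := by
  let i : Fin d := ⟨0, hd⟩
  obtain ⟨R, hRpos, hR⟩ := hΩ.exists_pos_norm_le
  have hcoord : ∀ᵐ x ∂volume.restrict Ω, |x i| ≤ R :=
    ae_restrict_subset (fun x hx => (norm_le_pi_norm x i).trans (hR x hx))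
      (ae_restrict_mem (isClosed_le (continuous_apply i).abs continuous_const).measurableSet)
  refine ⟨((2 * R) ^ 2 + 1)⁻¹, by positivity, fun u => ?_⟩
  have hfriedrichs : ‖toL2 u‖ ≤ 2 * R * gradNorm u :=
    (norm_toL2_le hRpos.le hcoord u).trans (by gcongr; exact norm_grad_le_gradNorm i u)
  rw [inv_mul_le_iff₀ (by positivity), norm_sq_eq, add_mul, one_mul, ← mul_pow]
  gcongr

theorem norm_toL2_le_of_orthogonal (𝒯 : RectMesh Ω) {w : H10 Ω}
    (hw : ∀ q ∈ polySpace 𝒯 0, ⟪toL2 w, q⟫_ℝ = 0) :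
    ‖toL2 w‖ ≤ √d * (2 * 𝒯.size) * gradNorm w := by
  obtain ⟨q, hq, hle⟩ := 𝒯.exists_mem_polySpace_norm_sub_le (p := 0) (f := toL2 w)
    (g := fun i => grad i w) fun K hK i => (IsIterWeakPDeriv.zero (𝒯.memLp_inner hK _)).succ
      (isWeakPDeriv (𝒯.inner_subset K hK) i w) (𝒯.memLp_inner hK _)
  have hle_sub : ‖toL2 w‖ ^ 2 ≤ ‖toL2 w - q‖ ^ 2 := by
    rw [norm_sub_sq_real, hw q hq]
    linarith [sq_nonneg ‖q‖]
  rw [zero_add, pow_one] at hle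
  exact (le_of_sq_le_sq hle_sub (norm_nonneg _)).trans hle

end H10

/-! ### Approximation of piecewise smooth functions -/

/-- The multi-index `j eᵢ` of the `j`-th derivative in direction `i`, for `j ≤ k`. -/
def MultiIdx.pure {k : ℕ} (i : Fin d) (j : Fin (k + 1)) : MultiIdx d k :=
  ⟨Pi.single i j, by
    rw [Finset.sum_eq_single i] <;> simp +contextual [Fin.is_le]⟩

theorem brokenSobolev.isIterWeakPDeriv {𝒯 : RectMesh Ω} {k : ℕ} (f : brokenSobolev 𝒯 k)
    {K : Rect d} (hK : K ∈ 𝒯.elems) (i : Fin d) (j : ℕ) (hj : j < k + 1) :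
    IsIterWeakPDeriv K.inner i (brokenToL2 f) j (f.1 (MultiIdx.pure i ⟨j, hj⟩)) := by
  induction j with
  | zero =>
    have hzero : MultiIdx.pure i ⟨0, hj⟩ = MultiIdx.zero d k := Subtype.ext (Pi.single_zero i)
    rw [hzero]
    exact .zero (𝒯.memLp_inner hK _)
  | succ j ih =>
    refine (ih (by omega)).succ (f.2 K hK i _ _ fun l => ?_) (𝒯.memLp_inner hK _)
    by_cases h : l = i
    · subst h
      simp [MultiIdx.pure]
    · simp [MultiIdx.pure, h]

theorem exists_mem_polySpace_norm_brokenToL2_sub_le {𝒯 : RectMesh Ω} {p : ℕ}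
    (f : brokenSobolev 𝒯 (p + 1)) :
    ∃ q ∈ polySpace 𝒯 p, ‖brokenToL2 f - q‖ ≤ d * (2 * 𝒯.size) ^ (p + 1) * ‖f‖ := by
  obtain ⟨q, hq, hle⟩ := 𝒯.exists_mem_polySpace_norm_sub_le fun K hK i =>
    brokenSobolev.isIterWeakPDeriv f hK i (p + 1) (Nat.lt_succ_self _)
  refine ⟨q, hq, hle.trans ?_⟩
  have hsize := 𝒯.size_nonneg
  calc √d * (2 * 𝒯.size) ^ (p + 1) *
        √(∑ i, ‖f.1 (MultiIdx.pure i ⟨p + 1, Nat.lt_succ_self _⟩)‖ ^ 2)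
      ≤ √d * (2 * 𝒯.size) ^ (p + 1) * √(∑ _i : Fin d, ‖f‖ ^ 2) := by
        gcongr
        exact PiLp.norm_apply_le f.1 _
    _ = d * (2 * 𝒯.size) ^ (p + 1) * ‖f‖ := by
        rw [Finset.sum_const, Finset.card_univ, Fintype.card_fin, nsmul_eq_mul,
          Real.sqrt_mul (by positivity), Real.sqrt_sq (norm_nonneg _)]
        linear_combination
          (2 * 𝒯.size) ^ (p + 1) * ‖f‖ * Real.mul_self_sqrt (Nat.cast_nonneg (α := ℝ) d)

/-! ### The energy form -/

section EnergyForm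

variable {A : (Fin d → ℝ) → ℝ} {a₀ b₀ : ℝ}

theorem IsCoefficient.memLp_top (hA : IsCoefficient Ω a₀ b₀ A) :
    MemLp A ⊤ (volume.restrict Ω) :=
  memLp_top_of_bound hA.measurable (max |a₀| |b₀|)
    (hA.bounds.mono fun _ hx => abs_le_max_abs_abs hx.1 hx.2)

theorem integrable_coeff_mul_mul (hA : MemLp A ⊤ (volume.restrict Ω)) (g h : L2 Ω) :
    Integrable (fun x => A x * g x * h x) (volume.restrict Ω) :=
  ((Lp.memLp g).mul (r := 2) hA).integrable_mul (Lp.memLp h)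

/-- The form `a(u, v) = (A ∇u, ∇v)` as a bounded bilinear form on `H¹₀(Ω)`. Only the boundedness of
`A` is required, so that `(A ∇u, ∇v)_{L²(K)}` is the form of the coefficient `1_K A`. -/
def formL (hA : MemLp A ⊤ (volume.restrict Ω)) : H10 Ω →L[ℝ] H10 Ω →L[ℝ] ℝ :=
  let gradL (i : Fin d) : H10 Ω →L[ℝ] L2 Ω :=
    (PiLp.proj 2 (fun _ : Option (Fin d) => L2 Ω) (some i)).comp (sobolevZero Ω Ω).subtypeL
  let mulL : L2 Ω →L[ℝ] L2 Ω :=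
    (ContinuousLinearMap.mul ℝ ℝ).holderL (volume.restrict Ω) ⊤ 2 2 (hA.toLp A)
  ∑ i, (innerSL ℝ).bilinearComp (mulL.comp (gradL i)) (gradL i)

theorem formL_apply (hA : MemLp A ⊤ (volume.restrict Ω)) (u v : H10 Ω) :
    formL hA u v = form A u v := by
  rw [formL, sum_apply, sum_apply, form, formOn]
  refine Finset.sum_congr rfl fun i _ => ?_
  refine (inner_eq_integral ((ContinuousLinearMap.mul ℝ ℝ).holder 2 (hA.toLp A) (grad i u))
    (grad i v)).trans (integral_congr_ae ?_)
  filter_upwards [(ContinuousLinearMap.mul ℝ ℝ).coeFn_holder (r := 2) (hA.toLp A) (grad i u),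
    hA.coeFn_toLp] with x hmul hx
  rw [hmul, hx, ContinuousLinearMap.mul_apply']

theorem form_indicator {S : Set (Fin d → ℝ)} (hS : MeasurableSet S) (hSΩ : S ⊆ Ω) (u v : H10 Ω) :
    form (S.indicator A) u v = formOn A S u v := by
  simp only [form, formOn, ← indicator_mul_left, setIntegral_indicator hS, inter_eq_right.2 hSΩ]

theorem form_comm (A : (Fin d → ℝ) → ℝ) (u v : H10 Ω) : form A u v = form A v u := by
  simp only [form, formOn, mul_right_comm]

theorem sum_formOn (hA : MemLp A ⊤ (volume.restrict Ω)) (𝒯 : RectMesh Ω) (u v : H10 Ω) :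
    ∑ K ∈ 𝒯.elems, formOn A K.inner u v = form A u v := by
  simp only [form, formOn]
  rw [Finset.sum_comm]
  exact Finset.sum_congr rfl fun i _ => (𝒯.integral_eq_sum (integrable_coeff_mul_mul hA _ _)).symm

theorem IsCoefficient.mul_gradNorm_sq_le_form (hA : IsCoefficient Ω a₀ b₀ A) (u : H10 Ω) :
    a₀ * gradNorm u ^ 2 ≤ form A u u := by
  rw [H10.gradNorm_sq, Finset.mul_sum]
  refine Finset.sum_le_sum fun i _ => ?_
  rw [norm_sq_eq_integral, ← integral_const_mul]
  refine integral_mono_ae ((Lp.memLp _).integrable_sq.const_mul _)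
    (integrable_coeff_mul_mul hA.memLp_top _ _) ?_
  filter_upwards [hA.bounds] with x hx
  rw [mul_assoc, ← sq]
  exact mul_le_mul_of_nonneg_right hx.1 (sq_nonneg _)

theorem IsCoefficient.isCoercive_formL (hA : IsCoefficient Ω a₀ b₀ A) (hd : 0 < d) (ha₀ : 0 < a₀)
    (hΩ : Bornology.IsBounded Ω) : IsCoercive (formL hA.memLp_top) := by
  obtain ⟨c, hc, hle⟩ := H10.exists_mul_norm_sq_le_gradNorm_sq hd hΩ
  refine ⟨a₀ * c, mul_pos ha₀ hc, fun u => ?_⟩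
  rw [formL_apply, mul_assoc, ← sq, mul_assoc]
  exact (mul_le_mul_of_nonneg_left (hle u) ha₀.le).trans (hA.mul_gradNorm_sq_le_form u)

end EnergyForm

/-! ### Coercive forms and complementary subspaces -/

section Coercive

variable {H : Type*} [NormedAddCommGroup H]

theorem eq_zero_of_isCoercive [NormedSpace ℝ H] {a : H →L[ℝ] H →L[ℝ] ℝ} (ha : IsCoercive a) {u : H}
    (hu : a u u = 0) : u = 0 := by
  obtain ⟨c, hc, hle⟩ := ha
  by_contra hne
  have hpos : 0 < ‖u‖ := norm_pos_iff.2 hne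
  exact (hle u).not_gt (hu ▸ mul_pos (mul_pos hc hpos) hpos)

variable [InnerProductSpace ℝ H] [CompleteSpace H] {a : H →L[ℝ] H →L[ℝ] ℝ} {W : Submodule ℝ H}

theorem existsUnique_mem_forall_apply_eq (ha : IsCoercive a) (hW : IsClosed (W : Set H))
    (F : StrongDual ℝ H) : ∃! e, e ∈ W ∧ ∀ w ∈ W, a e w = F w := by
  have : CompleteSpace W := hW.completeSpace_coe
  have hb : IsCoercive (a.bilinearComp W.subtypeL W.subtypeL) :=
    let ⟨c, hc, hle⟩ := ha
    ⟨c, hc, fun u => hle u⟩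
  let g : W := (InnerProductSpace.toDual ℝ W).symm (F.comp W.subtypeL)
  let e : W := hb.continuousLinearEquivOfBilin.symm g
  have he : ∀ w ∈ W, a e w = F w := fun w hw => by
    have hsolves := hb.continuousLinearEquivOfBilin_apply e ⟨w, hw⟩
    rw [ContinuousLinearEquiv.apply_symm_apply, InnerProductSpace.toDual_symm_apply] at hsolves
    exact hsolves.symm
  refine ⟨e, ⟨e.2, he⟩, fun e' he' => ?_⟩
  have hsub : e' - e ∈ W := W.sub_mem he'.1 e.2
  refine sub_eq_zero.1 (eq_zero_of_isCoercive ha ?_)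
  rw [map_sub a, sub_apply, he'.2 _ hsub, he _ hsub, sub_self]

theorem existsUnique_sub_mem_of_isCoercive (ha : IsCoercive a) (hW : IsClosed (W : Set H))
    (u : H) : ∃! q, u - q ∈ W ∧ ∀ w ∈ W, a q w = 0 := by
  obtain ⟨e, ⟨heW, he⟩, huniq⟩ := existsUnique_mem_forall_apply_eq ha hW (a u)
  refine ⟨u - e, ⟨by rwa [sub_sub_cancel], fun w hw => ?_⟩, fun q hq => ?_⟩
  · rw [map_sub a, sub_apply, he w hw, sub_self]
  · rw [← huniq (u - q) ⟨hq.1, fun w hw => ?_⟩, sub_sub_cancel]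
    rw [map_sub a, sub_apply, hq.2 w hw, sub_zero]

theorem galerkin_iff_sub_mem (ha : IsCoercive a) (hsymm : ∀ u v, a u v = a v u)
    (hW : IsClosed (W : Set H)) {V : Set H} (hV : ∀ z, z ∈ V ↔ ∀ w ∈ W, a z w = 0) {u q : H} :
    (q ∈ V ∧ ∀ z ∈ V, a q z = a u z) ↔ u - q ∈ W ∧ ∀ w ∈ W, a q w = 0 := by
  constructor
  · rintro ⟨hq, hgal⟩
    obtain ⟨q', ⟨hsub, hq'⟩, -⟩ := existsUnique_sub_mem_of_isCoercive ha hW u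
    have hdiff : q - q' ∈ V := (hV _).2 fun w hw => by
      rw [map_sub a, sub_apply, (hV q).1 hq w hw, hq' w hw, sub_self]
    have hself : a (q - q') (q - q') = 0 := by
      rw [map_sub a q, sub_apply, hgal _ hdiff, ← sub_apply, ← map_sub a, hsymm,
        (hV _).1 hdiff _ hsub]
    rw [sub_eq_zero.1 (eq_zero_of_isCoercive ha hself)]
    exact ⟨hsub, hq'⟩
  · rintro ⟨hsub, hq⟩
    refine ⟨(hV q).2 hq, fun z hz => ?_⟩
    rw [eq_comm, ← sub_eq_zero, ← sub_apply, ← map_sub a, hsymm, (hV z).1 hz _ hsub]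

end Coercive

/-! ### The fine space and the multiscale space -/

section Multiscale

variable {𝒯 : RectMesh Ω} {p : ℕ}

theorem polySpace_mono (𝒯 : RectMesh Ω) {p r : ℕ} (h : p ≤ r) : polySpace 𝒯 p ≤ polySpace 𝒯 r :=
  fun _ hv K hK => (hv K hK).imp fun _ hq => ⟨fun i => (hq.1 i).trans h, hq.2⟩

theorem inner_polyProj (v : L2 Ω) {q : L2 Ω} (hq : q ∈ polySpace 𝒯 p) :
    ⟪(polyProj 𝒯 p v : L2 Ω), q⟫_ℝ = ⟪v, q⟫_ℝ :=
  Submodule.inner_orthogonalProjectionOnto_eq_of_mem_right ⟨q, hq⟩ v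

/-- The fine space `W` as a subspace of `H¹₀(Ω)`. -/
def fineSubmodule (𝒯 : RectMesh Ω) (p : ℕ) : Submodule ℝ (H10 Ω) :=
  ((polySpace 𝒯 p).orthogonalProjectionOnto.comp toL2).ker

theorem mem_fineSubmodule {w : H10 Ω} : w ∈ fineSubmodule 𝒯 p ↔ w ∈ fineSpace 𝒯 p := Iff.rfl

theorem isClosed_fineSubmodule (𝒯 : RectMesh Ω) (p : ℕ) :
    IsClosed (fineSubmodule 𝒯 p : Set (H10 Ω)) :=
  ContinuousLinearMap.isClosed_ker _

theorem mem_fineSubmodule_iff_forall_inner_eq_zero {w : H10 Ω} :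
    w ∈ fineSubmodule 𝒯 p ↔ ∀ q ∈ polySpace 𝒯 p, ⟪toL2 w, q⟫_ℝ = 0 := by
  rw [fineSubmodule, LinearMap.mem_ker, ContinuousLinearMap.coe_coe, ContinuousLinearMap.comp_apply,
    Submodule.orthogonalProjectionOnto_eq_zero_iff, Submodule.mem_orthogonal']

theorem memLp_indicator_inner (K : Rect d) (v : L2 Ω) :
    MemLp (K.inner.indicator v) 2 (volume.restrict Ω) :=
  (Lp.memLp v).indicator K.measurableSet_inner

/-- The part `1_K v ∈ V_H` of `v ∈ V_H` that is supported in the element `K`. -/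
def elemPart (v : polySpace 𝒯 p) (K : 𝒯.elems) : polySpace 𝒯 p :=
  ⟨(memLp_indicator_inner K.1 v.1).toLp _, fun L hL => by
    have hcoe := ae_restrict_subset (𝒯.inner_subset L hL)
      (memLp_indicator_inner K.1 v.1).coeFn_toLp
    by_cases hLK : L = K
    · obtain ⟨q, hq, hvq⟩ := v.2 L hL
      refine ⟨q, hq, ?_⟩
      filter_upwards [hcoe, hvq, ae_restrict_mem L.measurableSet_inner] with x hx hxq hxL
      rw [hx, ← hLK, indicator_of_mem hxL, hxq]
    · refine ⟨0, by simp, ?_⟩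
      filter_upwards [hcoe, ae_restrict_mem L.measurableSet_inner] with x hx hxL
      rw [hx, indicator_of_notMem (disjoint_left.1 (𝒯.disjoint L hL K K.2 hLK) hxL), map_zero]⟩

theorem coeFn_elemPart (v : polySpace 𝒯 p) (K : 𝒯.elems) :
    (elemPart v K : L2 Ω) =ᵐ[volume.restrict Ω] K.1.inner.indicator (v : L2 Ω) :=
  (memLp_indicator_inner K.1 v.1).coeFn_toLp

theorem elemPart_ae_eq_zero (v : polySpace 𝒯 p) {K : 𝒯.elems} {L : Rect d} (hL : L ∈ 𝒯.elems)
    (hLK : L ≠ K) : (elemPart v K : L2 Ω) =ᵐ[volume.restrict L.inner] 0 := by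
  filter_upwards [ae_restrict_subset (𝒯.inner_subset L hL) (coeFn_elemPart v K),
    ae_restrict_mem L.measurableSet_inner] with x hx hxL
  rw [hx, indicator_of_notMem (disjoint_left.1 (𝒯.disjoint L hL K K.2 hLK) hxL), Pi.zero_apply]

theorem sum_elemPart (v : polySpace 𝒯 p) : ∑ K, elemPart v K = v := by
  refine Subtype.ext (Lp.ext (ae_of_forall_inner 𝒯 fun L hL => ?_))
  rw [Submodule.coe_sum]
  have hparts : ∀ᵐ x ∂volume.restrict Ω, ∀ K : 𝒯.elems,
      (elemPart v K : L2 Ω) x = K.1.inner.indicator (v : L2 Ω) x :=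
    ae_all_iff.2 (coeFn_elemPart v)
  filter_upwards [ae_restrict_subset (𝒯.inner_subset L hL) hparts,
    ae_restrict_subset (𝒯.inner_subset L hL) (Lp.coeFn_fun_finsetSum Finset.univ
      fun K => (elemPart v K : L2 Ω)), ae_restrict_mem L.measurableSet_inner] with x hx hsum hxL
  rw [hsum, Finset.sum_congr rfl fun K _ => hx K, Finset.sum_eq_single ⟨L, hL⟩]
  · exact indicator_of_mem hxL _
  · intro K _ hK
    refine indicator_of_notMem (disjoint_right.1 (𝒯.disjoint K K.2 L hL ?_) hxL) _
    exact fun h => hK (Subtype.ext h)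
  · exact fun h => (h (Finset.mem_univ _)).elim

variable {B : polySpace 𝒯 p →ₗ[ℝ] H10 Ω}

theorem IsBubbleOperator.inner_eq (hB : IsBubbleOperator 𝒯 p B) (v : polySpace 𝒯 p) {q : L2 Ω}
    (hq : q ∈ polySpace 𝒯 p) : ⟪toL2 (B v), q⟫_ℝ = ⟪(v : L2 Ω), q⟫_ℝ := by
  rw [← sum_elemPart v, map_sum, map_sum, sum_inner, Submodule.coe_sum, sum_inner]
  exact Finset.sum_congr rfl fun K _ =>
    (hB K K.2 (elemPart v K) fun _ hL hLK => elemPart_ae_eq_zero v hL hLK).2 q hq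

theorem IsBubbleOperator.inner_stabInterp (hB : IsBubbleOperator 𝒯 p B)
    (E : polySpace 𝒯 0 →ₗ[ℝ] affineZero 𝒯) (v : L2 Ω) {q : L2 Ω} (hq : q ∈ polySpace 𝒯 p) :
    ⟪toL2 (stabInterp 𝒯 p E B v), q⟫_ℝ = ⟪v, q⟫_ℝ := by
  rw [stabInterp, map_add, inner_add_left, hB.inner_eq _ hq, inner_polyProj _ hq, inner_sub_left]
  ring

variable {A : (Fin d → ℝ) → ℝ} {a₀ b₀ : ℝ}

theorem exists_isElementCorrection (hA : MemLp A ⊤ (volume.restrict Ω))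
    (hcoer : IsCoercive (formL hA)) {K : Rect d} (hK : K ∈ 𝒯.elems) (v : H10 Ω) :
    ∃ c, IsElementCorrection 𝒯 p A K v c := by
  obtain ⟨c, ⟨hmem, hc⟩, -⟩ := existsUnique_mem_forall_apply_eq hcoer
    (isClosed_fineSubmodule 𝒯 p) (formL (hA.indicator K.measurableSet_inner) v)
  refine ⟨c, hmem, fun w hw => ?_⟩
  rw [← formL_apply hA, hc w hw, formL_apply,
    form_indicator K.measurableSet_inner (𝒯.inner_subset K hK)]

theorem isCorrection_iff (hA : MemLp A ⊤ (volume.restrict Ω)) (hcoer : IsCoercive (formL hA))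
    {v c : H10 Ω} : IsCorrection 𝒯 p A v c ↔
      c ∈ fineSubmodule 𝒯 p ∧ ∀ w ∈ fineSubmodule 𝒯 p, formL hA c w = formL hA v w := by
  have hsum : ∀ {cK : Rect d → H10 Ω}, (∀ K ∈ 𝒯.elems, IsElementCorrection 𝒯 p A K v (cK K)) →
      ∑ K ∈ 𝒯.elems, cK K ∈ fineSubmodule 𝒯 p ∧
        ∀ w ∈ fineSubmodule 𝒯 p, formL hA (∑ K ∈ 𝒯.elems, cK K) w = formL hA v w := fun hcK => by
    refine ⟨Submodule.sum_mem _ fun K hK => (hcK K hK).1, fun w hw => ?_⟩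
    rw [formL_apply hA v, map_sum, sum_apply, ← sum_formOn hA 𝒯]
    exact Finset.sum_congr rfl fun K hK => (formL_apply hA _ w).trans ((hcK K hK).2 w hw)
  constructor
  · rintro ⟨cK, hcK, rfl⟩
    exact hsum hcK
  · intro hc
    have helem : ∀ K ∈ 𝒯.elems, ∃ cK, IsElementCorrection 𝒯 p A K v cK :=
      fun K hK => exists_isElementCorrection hA hcoer hK v
    choose! cK hcK using helem
    exact ⟨cK, hcK, (existsUnique_mem_forall_apply_eq hcoer (isClosed_fineSubmodule 𝒯 p)
      (formL hA v)).unique hc (hsum hcK)⟩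

theorem mem_multiscaleSpace_iff (hA : MemLp A ⊤ (volume.restrict Ω))
    (hcoer : IsCoercive (formL hA)) (E : polySpace 𝒯 0 →ₗ[ℝ] affineZero 𝒯)
    (hB : IsBubbleOperator 𝒯 p B) (z : H10 Ω) :
    z ∈ multiscaleSpace 𝒯 p A E B ↔ ∀ w ∈ fineSubmodule 𝒯 p, formL hA z w = 0 := by
  constructor
  · rintro ⟨v, -, c, hc, rfl⟩ w hw
    rw [map_sub, sub_apply, ((isCorrection_iff hA hcoer).1 hc).2 w hw, sub_self]
  · intro hz
    let v := stabInterp 𝒯 p E B (polyProj 𝒯 p (toL2 z))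
    have hmem : v - z ∈ fineSubmodule 𝒯 p := by
      refine mem_fineSubmodule_iff_forall_inner_eq_zero.2 fun q hq => ?_
      rw [map_sub, inner_sub_left, hB.inner_stabInterp E _ hq, inner_polyProj _ hq, sub_self]
    refine ⟨v, ⟨_, (polyProj 𝒯 p (toL2 z)).2, rfl⟩, v - z,
      (isCorrection_iff hA hcoer).2 ⟨hmem, fun w hw => ?_⟩, (sub_sub_cancel v z).symm⟩
    rw [map_sub, sub_apply, hz w hw, sub_zero]

theorem isMultiscaleProj_iff (hA : MemLp A ⊤ (volume.restrict Ω))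
    (hcoer : IsCoercive (formL hA)) (E : polySpace 𝒯 0 →ₗ[ℝ] affineZero 𝒯)
    (hB : IsBubbleOperator 𝒯 p B) {u q : H10 Ω} :
    IsMultiscaleProj A (multiscaleSpace 𝒯 p A E B) u q ↔
      u - q ∈ fineSubmodule 𝒯 p ∧ ∀ w ∈ fineSubmodule 𝒯 p, formL hA q w = 0 := by
  have hsymm : ∀ u v, formL hA u v = formL hA v u := fun u v => by
    rw [formL_apply, formL_apply, form_comm]
  rw [← galerkin_iff_sub_mem hcoer hsymm (isClosed_fineSubmodule 𝒯 p)
    (mem_multiscaleSpace_iff hA hcoer E hB)]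
  simp only [IsMultiscaleProj, formL_apply]

theorem isEnrichedCorrection_iff (hA : MemLp A ⊤ (volume.restrict Ω)) {F : HMinusOne Ω}
    {e : H10 Ω} : IsEnrichedCorrection 𝒯 p A F e ↔
      e ∈ fineSubmodule 𝒯 p ∧ ∀ w ∈ fineSubmodule 𝒯 p, formL hA e w = (-F) w := by
  simp only [IsEnrichedCorrection, formL_apply, mem_fineSubmodule, neg_apply]

theorem IsCoefficient.gradNorm_le_of_mem_fineSubmodule (hA : IsCoefficient Ω a₀ b₀ A)
    (ha₀ : 0 < a₀) (f : brokenSobolev 𝒯 (p + 1)) {z : H10 Ω} (hz : z ∈ fineSubmodule 𝒯 p)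
    (hzf : form A z z = toDual (brokenToL2 f) z) :
    gradNorm z ≤ a₀⁻¹ * (d * 2 ^ (p + 1)) * (√d * 2) * 𝒯.size ^ (p + 2) * ‖f‖ := by
  have horth := mem_fineSubmodule_iff_forall_inner_eq_zero.1 hz
  obtain ⟨r, hr, hfr⟩ := exists_mem_polySpace_norm_brokenToL2_sub_le f
  have hpoincare : ‖toL2 z‖ ≤ √d * (2 * 𝒯.size) * gradNorm z :=
    H10.norm_toL2_le_of_orthogonal 𝒯 fun q hq => horth q (polySpace_mono 𝒯 (Nat.zero_le p) hq)
  have hsize := 𝒯.size_nonneg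
  have hnonneg : 0 ≤ gradNorm z := Real.sqrt_nonneg _
  have henergy : a₀ * gradNorm z ^ 2 ≤
      d * (2 * 𝒯.size) ^ (p + 1) * ‖f‖ * (√d * (2 * 𝒯.size) * gradNorm z) := calc
    a₀ * gradNorm z ^ 2 ≤ form A z z := hA.mul_gradNorm_sq_le_form z
    _ = ⟪brokenToL2 f, toL2 z⟫_ℝ := hzf
    _ = ⟪brokenToL2 f - r, toL2 z⟫_ℝ := by
      rw [inner_sub_left, real_inner_comm (toL2 z) r, horth r hr, sub_zero]
    _ ≤ ‖brokenToL2 f - r‖ * ‖toL2 z‖ := real_inner_le_norm _ _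
    _ ≤ _ := by gcongr
  have hbound : a₀ * gradNorm z ≤ d * (2 * 𝒯.size) ^ (p + 1) * ‖f‖ * (√d * (2 * 𝒯.size)) := by
    rcases hnonneg.eq_or_lt with hzero | hpos
    · rw [← hzero, mul_zero]
      positivity
    · exact le_of_mul_le_mul_right (by linarith) hpos
  calc gradNorm z ≤ a₀⁻¹ * (d * (2 * 𝒯.size) ^ (p + 1) * ‖f‖ * (√d * (2 * 𝒯.size))) :=
        (le_inv_mul_iff₀ ha₀).2 hbound
    _ = _ := by
      rw [mul_pow]
      ring

end Multiscale

end MultiscaleHeat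

end

open MultiscaleHeat in
theorem mainTheorem3_general (d p : ℕ) (hd : 0 < d) (a₀ : ℝ) (ha₀ : 0 < a₀) :
    ∃ C : ℝ, 0 < C ∧
      ∀ (Ω : Set (Fin d → ℝ)) (b₀ : ℝ) (A : (Fin d → ℝ) → ℝ) (_ : IsCoefficient Ω a₀ b₀ A)
        (𝒯 : RectMesh Ω)
        (E : polySpace 𝒯 0 →ₗ[ℝ] affineZero 𝒯)
        (B : polySpace 𝒯 p →ₗ[ℝ] H10 Ω) (_ : IsBubbleOperator 𝒯 p B)
        (f : brokenSobolev 𝒯 (p + 1)) (F : HMinusOne Ω) (u : H10 Ω)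
        (_ : ∀ v : H10 Ω, F v + form A u v = toDual (brokenToL2 f) v),
        (∃! q, IsMultiscaleProj A (multiscaleSpace 𝒯 p A E B) u q) ∧
        (∃! e, IsEnrichedCorrection 𝒯 p A F e) ∧
        ∀ q e, IsMultiscaleProj A (multiscaleSpace 𝒯 p A E B) u q →
          IsEnrichedCorrection 𝒯 p A F e →
          gradNorm (u - (q + e)) ≤ C * 𝒯.size ^ (p + 2) * ‖f‖ := by
  refine ⟨a₀⁻¹ * (d * 2 ^ (p + 1)) * (√d * 2), by positivity, ?_⟩
  intro Ω b₀ A hA 𝒯 E B hB f F u hu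
  have hcoer := hA.isCoercive_formL hd ha₀ 𝒯.isBounded
  have hW := isClosed_fineSubmodule 𝒯 p
  simp only [isMultiscaleProj_iff hA.memLp_top hcoer E hB,
    isEnrichedCorrection_iff hA.memLp_top]
  refine ⟨existsUnique_sub_mem_of_isCoercive hcoer hW u,
    existsUnique_mem_forall_apply_eq hcoer hW (-F), ?_⟩
  rintro q e ⟨hqW, hq⟩ ⟨heW, he⟩
  have hz : u - (q + e) ∈ fineSubmodule 𝒯 p := by
    rw [← sub_sub]
    exact Submodule.sub_mem _ hqW heW
  refine hA.gradNorm_le_of_mem_fineSubmodule ha₀ f hz ?_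
  rw [← formL_apply hA.memLp_top]
  nth_rw 1 [map_sub (formL hA.memLp_top), map_add (formL hA.memLp_top)]
  rw [sub_apply, add_apply, hq _ hz, he _ hz, formL_apply, ← hu, neg_apply]
  ring

open MultiscaleHeat in
theorem mainTheorem3 (d k p : ℕ) (hd : 0 < d) (hp : k = p + 1) (a₀ : ℝ) (ha₀ : 0 < a₀) :
    ∃ C : ℝ, 0 < C ∧
      ∀ (Ω : Set (Fin d → ℝ)) (_ : IsOpen Ω) (_ : Bornology.IsBounded Ω)
        (T : ℝ) (_ : 0 < T)
        (b₀ : ℝ) (A : (Fin d → ℝ) → ℝ) (_ : IsCoefficient Ω a₀ b₀ A)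
        (𝒯 : RectMesh Ω)
        (E : polySpace 𝒯 0 →ₗ[ℝ] affineZero 𝒯)
        (B : polySpace 𝒯 p →ₗ[ℝ] H10 Ω) (_ : IsBubbleOperator 𝒯 p B)
        (u₀ : H10 Ω) (f : ℝ → brokenSobolev 𝒯 k) (_ : ContinuousOn f (Set.Icc 0 T))
        (u : ℝ → H10 Ω) (_ : IsWeakSolution A T u₀ (fun t => brokenToL2 (f t)) u),
        ∀ t ∈ Set.Icc 0 T,
          (∃! q, IsMultiscaleProj A (multiscaleSpace 𝒯 p A E B) (u t) q) ∧
          (∃! e, IsEnrichedCorrection 𝒯 p A (timeDeriv T u t) e) ∧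
          ∀ q e, IsMultiscaleProj A (multiscaleSpace 𝒯 p A E B) (u t) q →
            IsEnrichedCorrection 𝒯 p A (timeDeriv T u t) e →
            gradNorm (u t - (q + e)) ≤ C * 𝒯.size ^ (p + 2) * ⨆ s : Set.Icc 0 T, ‖f s‖ := by
  subst hp
  obtain ⟨C, hC, hmain⟩ := mainTheorem3_general d p hd a₀ ha₀
  refine ⟨C, hC, fun Ω _ _ T _ b₀ A hA 𝒯 E B hB u₀ f hf u hu t ht => ?_⟩
  obtain ⟨hproj, hcorr, hle⟩ := hmain Ω b₀ A hA 𝒯 E B hB (f t) (timeDeriv T u t) (u t) (hu.eqn t ht)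
  have hsize := 𝒯.size_nonneg
  exact ⟨hproj, hcorr, fun q e hq he => (hle q e hq he).trans <|
    mul_le_mul_of_nonneg_left (norm_le_iSup_norm isCompact_Icc hf ht) (by positivity)⟩
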